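/- Let $\mathcal C$ be a unital $C^*$-algebra and $\mathcal D\subseteq\mathcal C$ an abelian $C^*$-subalgebra containing the unit of $\mathcal C$, with Gelfand space $\hat{\mathcal D}$. Put $\mathcal N=\{v\in\mathcal C: v^*\mathcal Dv\cup v\mathcal Dv^*\subseteq\mathcal D\}$ and assume that $\mathcal N$ has dense linear span in $\mathcal C$. Let $F$ be a compatible cover for $\hat{\mathcal D}$, that is, a weak-$*$ closed set of states $\rho$ of $\mathcal C$ such that * $|\rho(v)|^2\in\{0,\rho(v^*v)\}$ for all $\rho\in F$ and $v\in\mathcal N$; * if $\rho\in F$, $v\in\mathcal N$ and $\rho(v^*v)>0$, then the state $x\mapsto\rho(v^*xv)/\rho(v^*v)$ is in $F$; * $\{\rho|_{\mathcal D}:\rho\in F\}=\hat{\mathcal D}$. An eigenfunctional is a nonzero $\phi\in\mathcal C^*$ that is an eigenvector for the left and the right action of $\mathcal D$, so that $\phi(d_1xd_2)=\rho(d_1)\phi(x)\sigma(d_2)$ for unique $\rho,\sigma\in\hat{\mathcal D}$; it is compatible if $|\phi(v)|^2\in\{0,\sigma(v^*v)\}$ for all $v\in\mathcal N$. For a compatible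 eigenfunctional $\phi$ of norm one let $\mathfrak s(\phi)$ and $\mathfrak r(\phi)$ be the unique states of $\mathcal C$ that restrict to characters of $\mathcal D$ and satisfy $\phi(vx)=\phi(v)\,\mathfrak s(\phi)(x)$ and $\phi(xv)=\mathfrak r(\phi)(x)\,\phi(v)$ for all $x\in\mathcal C$ and all $v\in\mathcal N$ with $\phi(v)\ne0$. Let $\mathcal E^1_F(\mathcal C,\mathcal D)$ be the set of all compatible eigenfunctionals $\phi$ of norm one with $\mathfrak s(\phi)\in F$, with the relative weak-$*$ topology, and let $\mathfrak R_F(\mathcal C,\mathcal D)=\{|\phi|:\phi\in\mathcal E^1_F(\mathcal C,\mathcal D)\}$, where $|\phi|(x)=|\phi(x)|$, with the topology of pointwise convergence on $\mathcal C$. For $v\in\mathcal N$ and a state $f$ with $f(v^*v)>0$ write $[v,f](x)=f(v^*x)/f(v^*v)^{1/2}$. Define $(\phi,\psi)$ to be composable in $\mathcal E^1_F(\mathcal C,\mathcal D)$ if $\mathfrak s(\phi)=\mathfrak r(\psi)$, with product $\phi\psi=[vw,\mathfrak s(\psi)]$ for any $v,w\in\mathcal N$ with $\phi(v)>0$ and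 $\psi(w)>0$, and put $\phi^{-1}(x)=\overline{\phi(x^*)}$. In $\mathfrak R_F(\mathcal C,\mathcal D)$ let $(|\phi|,|\psi|)$ be composable when $(\phi,\psi)$ is, with product $|\phi\psi|$, and put $|\phi|^{-1}=|\phi^{-1}|$. Then these operations are well defined, and $\mathcal E^1_F(\mathcal C,\mathcal D)$ and $\mathfrak R_F(\mathcal C,\mathcal D)$ are locally compact Hausdorff topological groupoids, with source and range maps $\phi\mapsto\mathfrak s(\phi),\mathfrak r(\phi)$ and $|\phi|\mapsto\mathfrak s(\phi),\mathfrak r(\phi)$; the groupoid $\mathfrak R_F(\mathcal C,\mathcal D)$ is étale. The unit space of each is $F$, where $f\in F$ is identified with $|f|$ in $\mathfrak R_F(\mathcal C,\mathcal D)$; this identification is a homeomorphism of $F$ onto the unit space of $\mathfrak R_F(\mathcal C,\mathcal D)$. Moreover, with $\iota(z,f)=zf$ and $\mathfrak q(\phi)=|\phi|$, $$\mathbb T\times F\overset{\iota}{\hookrightarrow}\mathcal E^1_F(\mathcal C,\mathcal D)\overset{\mathfrak q}{\twoheadrightarrow}\mathfrak R_F(\mathcal C,\mathcal D)$$ is a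 locally trivial Hausdorff twist: $\iota$ and $\mathfrak q$ are continuous groupoid homomorphisms, $\iota$ is injective and $\mathfrak q$ is surjective; $\mathfrak q^{-1}(F)=\iota(\mathbb T\times F)$; $\iota|_{\{1\}\times F}$ and the restriction of $\mathfrak q$ to the unit space are homeomorphisms onto the unit spaces of $\mathcal E^1_F(\mathcal C,\mathcal D)$ and $\mathfrak R_F(\mathcal C,\mathcal D)$; $\iota(z,\mathfrak r(\phi))\,\phi=\phi\,\iota(z,\mathfrak s(\phi))$ for all $\phi\in\mathcal E^1_F(\mathcal C,\mathcal D)$ and $z\in\mathbb T$; and each $g\in\mathfrak R_F(\mathcal C,\mathcal D)$ has an open bisection $U\ni g$ with a continuous section $j:U\to\mathcal E^1_F(\mathcal C,\mathcal D)$ of $\mathfrak q$ such that $(z,h)\mapsto\iota(z,\mathfrak r(h))\,j(h)$ is a homeomorphism of $\mathbb T\times U$ onto $\mathfrak q^{-1}(U)$. -/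

import Mathlib

open scoped ComplexOrder ComplexConjugate

namespace RegIncl

/-! ### Groupoids -/

/-- A groupoid, as a set `X` with a set of composable pairs, a product defined on composable
pairs, and an inversion. -/
structure SetGroupoid (X : Type*) where
  /-- `Comp a b` says that `(a, b)` is a composable pair. -/
  Comp : X → X → Prop
  /-- The product of a composable pair. -/
  mul : ∀ a b : X, Comp a b → X
  /-- The inverse. -/
  inv : X → X
  inv_inv : ∀ a, inv (inv a) = a
  assoc : ∀ (a b c : X) (hab : Comp a b) (hbc : Comp b c),
    ∃ (h₁ : Comp (mul a b hab) c) (h₂ : Comp a (mul b c hbc)),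
      mul (mul a b hab) c h₁ = mul a (mul b c hbc) h₂
  inv_comp : ∀ a, Comp (inv a) a
  comp_inv : ∀ a, Comp a (inv a)
  inv_mul_cancel : ∀ (a b : X) (h : Comp a b),
    ∃ h' : Comp (inv a) (mul a b h), mul (inv a) (mul a b h) h' = b
  mul_inv_cancel : ∀ (a b : X) (h : Comp a b),
    ∃ h' : Comp (mul a b h) (inv b), mul (mul a b h) (inv b) h' = a

namespace SetGroupoid

/-- The range `r(a) = a a⁻¹`. -/
def range {X : Type*} (G : SetGroupoid X) (a : X) : X := G.mul a (G.inv a) (G.comp_inv a)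

/-- The source `s(a) = a⁻¹ a`. -/
def source {X : Type*} (G : SetGroupoid X) (a : X) : X := G.mul (G.inv a) a (G.inv_comp a)

/-- The unit space `{g : g = g⁻¹ g}`. -/
def units {X : Type*} (G : SetGroupoid X) : Set X := {g | g = G.source g}

theorem mul_congr {X : Type*} (G : SetGroupoid X) {a a' b b' : X} (ha : a = a') (hb : b = b')
    (h : G.Comp a b) : ∃ h' : G.Comp a' b', G.mul a b h = G.mul a' b' h' := by
  subst ha; subst hb; exact ⟨h, rfl⟩

theorem mem_units_of_idem {X : Type*} (G : SetGroupoid X) (u : X) (h : G.Comp u u)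
    (hu : G.mul u u h = u) : u ∈ G.units := by
  obtain ⟨h', e⟩ := G.inv_mul_cancel u u h
  obtain ⟨_, e'⟩ := G.mul_congr rfl hu h'
  exact e.symm.trans e'

theorem range_mem_units {X : Type*} (G : SetGroupoid X) (a : X) : G.range a ∈ G.units := by
  obtain ⟨h₁, e₁⟩ := G.inv_mul_cancel a (G.inv a) (G.comp_inv a)
  obtain ⟨h₂, _, _⟩ := G.assoc a (G.inv a) a (G.comp_inv a) (G.inv_comp a)
  obtain ⟨h₃, h₄, e₂⟩ := G.assoc (G.range a) a (G.inv a) h₂ (G.comp_inv a)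
  obtain ⟨h₅, h₆, e₃⟩ := G.assoc a (G.inv a) (G.range a) (G.comp_inv a) h₁
  refine G.mem_units_of_idem _ h₄ ?_
  obtain ⟨_, e₄⟩ := G.mul_congr rfl e₁ h₆
  exact e₃.trans e₄

theorem source_mem_units {X : Type*} (G : SetGroupoid X) (a : X) : G.source a ∈ G.units := by
  obtain ⟨h₁, e₁⟩ := G.mul_inv_cancel (G.inv a) a (G.inv_comp a)
  obtain ⟨h₂, h₃, e₂⟩ := G.assoc (G.source a) (G.inv a) a h₁ (G.inv_comp a)
  refine G.mem_units_of_idem _ h₃ ?_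
  obtain ⟨_, e₄⟩ := G.mul_congr e₁ rfl h₂
  exact e₂.symm.trans e₄

/-- The range map onto the unit space. -/
def rangeMap {X : Type*} (G : SetGroupoid X) (a : X) : G.units := ⟨G.range a, G.range_mem_units a⟩

/-- The source map onto the unit space. -/
def sourceMap {X : Type*} (G : SetGroupoid X) (a : X) : G.units :=
  ⟨G.source a, G.source_mem_units a⟩

/-- A groupoid homomorphism: it carries composable pairs to composable pairs and products to
products. -/
def IsHom {X Y : Type*} (G : SetGroupoid X) (H : SetGroupoid Y) (f : X → Y) : Prop :=
  ∀ (a b : X) (h : G.Comp a b), ∃ h' : H.Comp (f a) (f b), f (G.mul a b h) = H.mul (f a) (f b) h'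

/-- A topological groupoid: product (on composable pairs) and inversion are continuous. -/
structure IsTopological {X : Type*} [TopologicalSpace X] (G : SetGroupoid X) : Prop where
  continuous_mul : Continuous fun p : {p : X × X // G.Comp p.1 p.2} => G.mul p.1.1 p.1.2 p.2
  continuous_inv : Continuous G.inv

/-- An étale groupoid: a locally compact topological groupoid whose range map is a local
homeomorphism onto the unit space. -/
structure IsEtale {X : Type*} [TopologicalSpace X] (G : SetGroupoid X) : Prop where
  isTopological : G.IsTopological
  locallyCompact : LocallyCompactSpace X
  isLocalHomeomorph : IsLocalHomeomorph G.rangeMap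

/-- A bisection: a set contained in an open set on which the range and the source map are
homeomorphisms onto open subsets of the unit space. -/
def IsBisection {X : Type*} [TopologicalSpace X] (G : SetGroupoid X) (S : Set X) : Prop :=
  ∃ V : Set X, IsOpen V ∧ S ⊆ V ∧
    Topology.IsOpenEmbedding (V.domRestrict G.rangeMap) ∧
    Topology.IsOpenEmbedding (V.domRestrict G.sourceMap)

/-- The product groupoid `𝕋 × U` of the circle group with a set `U` consisting of units only. -/
noncomputable def circleProd (U : Type*) : SetGroupoid (Circle × U) where
  Comp p q := p.2 = q.2
  mul p q _ := (p.1 * q.1, p.2)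
  inv p := (p.1⁻¹, p.2)
  inv_inv p := by simp
  assoc a b c hab hbc := ⟨hab.trans hbc, hab, by simp [mul_assoc]⟩
  inv_comp _ := rfl
  comp_inv _ := rfl
  inv_mul_cancel a b h := ⟨rfl, by ext <;> simp [h]⟩
  mul_inv_cancel a b h := ⟨h, by ext <;> simp⟩

end SetGroupoid

/-- A twist `𝕋 × G⁰ ↪ Σ ↠ G` over the étale groupoid `G`, where `S` is the groupoid structure of
`Σ`.  Units of `Σ` and of `G` are identified through `q`, so that a unit `r(γ)` of `Σ` becomes the
unit `q(r(γ)) = r(q(γ))` of `G`. -/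
structure IsTwist {X Y : Type*} [TopologicalSpace X] [TopologicalSpace Y]
    (S : SetGroupoid X) (G : SetGroupoid Y) (ι : Circle × G.units → X) (q : X → Y) : Prop where
  isTopological : S.IsTopological
  locallyCompact : LocallyCompactSpace X
  isEtale : G.IsEtale
  ι_continuous : Continuous ι
  q_continuous : Continuous q
  ι_hom : (SetGroupoid.circleProd G.units).IsHom S ι
  q_hom : S.IsHom G q
  ι_injective : Function.Injective ι
  q_surjective : Function.Surjective q
  preimage_units : q ⁻¹' G.units = Set.range ι
  ι_one_embedding : Topology.IsEmbedding fun u : G.units => ι (1, u)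
  ι_one_range : (Set.range fun u : G.units => ι (1, u)) = S.units
  q_units_embedding : Topology.IsEmbedding fun u : S.units => q u
  q_units_range : (Set.range fun u : S.units => q u) = G.units
  central : ∀ (γ : X) (z : Circle),
    ∃ (h₁ : S.Comp (ι (z, G.rangeMap (q γ))) γ) (h₂ : S.Comp γ (ι (z, G.sourceMap (q γ)))),
      S.mul _ _ h₁ = S.mul _ _ h₂
  locally_trivial : ∀ g : Y, ∃ U : Set Y, IsOpen U ∧ G.IsBisection U ∧ g ∈ U ∧
    ∃ j : U → X, Continuous j ∧ (∀ u, q (j u) = u) ∧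
      ∃ h : ∀ (z : Circle) (u : U), S.Comp (ι (z, G.rangeMap u)) (j u),
        Topology.IsEmbedding (fun p : Circle × U => S.mul _ _ (h p.1 p.2)) ∧
        (Set.range fun p : Circle × U => S.mul _ _ (h p.1 p.2)) = q ⁻¹' U

/-! ### Inclusions, states and eigenfunctionals -/

/-- The set of normalizers `{v : v* D v ∪ v D v* ⊆ D}`. -/
def normalizers {C : Type*} [CStarAlgebra C] (D : StarSubalgebra ℂ C) : Set C :=
  {v | ∀ d ∈ D, star v * d * v ∈ D ∧ v * d * star v ∈ D}

theorem star_mul_self_mem {C : Type*} [CStarAlgebra C] {D : StarSubalgebra ℂ C} {v : C}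
    (hv : v ∈ normalizers D) : star v * v ∈ D := by
  simpa using (hv 1 (one_mem D)).1

/-- A regular inclusion `(C, D)`: `D` is an abelian `C*`-subalgebra of `C` containing its unit,
and the normalizers have dense span in `C`. -/
structure IsRegularInclusion {C : Type*} [CStarAlgebra C] (D : StarSubalgebra ℂ C) : Prop where
  isClosed : IsClosed (D : Set C)
  comm : ∀ a ∈ D, ∀ b ∈ D, a * b = b * a
  dense_span : Dense (Submodule.span ℂ (normalizers D) : Set C)

/-- States of `C`. -/
def states (C : Type*) [CStarAlgebra C] : Set (WeakDual ℂ C) :=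
  {f | (∀ x, 0 ≤ f (star x * x)) ∧ f 1 = 1}

/-- The set `Mod(C, D)` of states of `C` that restrict to characters of `D`. -/
def modStates {C : Type*} [CStarAlgebra C] (D : StarSubalgebra ℂ C) : Set (WeakDual ℂ C) :=
  {f | f ∈ states C ∧ ∃ σ : WeakDual.characterSpace ℂ D, ∀ d : D, f d = σ d}

/-- Compatible states: `|f(v)|² ∈ {0, f(v* v)}` for all normalizers `v`. -/
def compatibleStates {C : Type*} [CStarAlgebra C] (D : StarSubalgebra ℂ C) :
    Set (WeakDual ℂ C) :=
  {f | f ∈ states C ∧ ∀ v ∈ normalizers D, f v = 0 ∨ ((‖f v‖ ^ 2 : ℝ) : ℂ) = f (star v * v)}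

/-- A compatible cover of the Gelfand space of `D`: a weak-* closed set of compatible states,
invariant under the maps `f ↦ f(v* · v) / f(v* v)` (`v` a normalizer with `f(v* v) > 0`), that
restricts onto the Gelfand space of `D`. -/
structure IsCompatibleCover {C : Type*} [CStarAlgebra C] (D : StarSubalgebra ℂ C)
    (F : Set (WeakDual ℂ C)) : Prop where
  subset : F ⊆ compatibleStates D
  isClosed : IsClosed F
  invariant : ∀ v ∈ normalizers D, ∀ f ∈ F, 0 < f (star v * v) →
    ∃ g ∈ F, ∀ x, g x = f (star v * x * v) / f (star v * v)
  covers : ∀ σ : WeakDual.characterSpace ℂ D, ∃ f ∈ F, ∀ d : D, f d = σ d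

/-- An eigenfunctional: a nonzero functional that is an eigenvector for the left and for the right
action of `D`. -/
def IsEigenfunctional {C : Type*} [CStarAlgebra C] (D : StarSubalgebra ℂ C)
    (φ : WeakDual ℂ C) : Prop :=
  φ ≠ 0 ∧ (∀ d ∈ D, ∃ c : ℂ, ∀ x, φ (d * x) = c * φ x) ∧
    ∀ d ∈ D, ∃ c : ℂ, ∀ x, φ (x * d) = c * φ x

/-- `σ` is the character `s(φ)` of `D`, determined by `φ(x d) = φ(x) σ(d)`. -/
def HasSourceChar {C : Type*} [CStarAlgebra C] (D : StarSubalgebra ℂ C)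
    (φ : WeakDual ℂ C) (σ : WeakDual.characterSpace ℂ D) : Prop :=
  ∀ (x : C) (d : D), φ (x * d) = φ x * σ d

/-- A compatible eigenfunctional: `|φ(v)|² ∈ {0, s(φ)(v* v)}` for all normalizers `v`. -/
def IsCompatibleEigenfunctional {C : Type*} [CStarAlgebra C] (D : StarSubalgebra ℂ C)
    (φ : WeakDual ℂ C) : Prop :=
  IsEigenfunctional D φ ∧ ∃ σ : WeakDual.characterSpace ℂ D, HasSourceChar D φ σ ∧
    ∀ (v : C) (hv : v ∈ normalizers D),
      φ v = 0 ∨ ((‖φ v‖ ^ 2 : ℝ) : ℂ) = σ ⟨star v * v, star_mul_self_mem hv⟩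

/-- `f` is the source state of `φ`: `φ(v x) = φ(v) f(x)` for normalizers `v` with `φ(v) ≠ 0`. -/
def IsSourceState {C : Type*} [CStarAlgebra C] (D : StarSubalgebra ℂ C)
    (φ f : WeakDual ℂ C) : Prop :=
  f ∈ modStates D ∧ ∀ v ∈ normalizers D, φ v ≠ 0 → ∀ x, φ (v * x) = φ v * f x

/-- `f` is the range state of `φ`: `φ(x v) = f(x) φ(v)` for normalizers `v` with `φ(v) ≠ 0`. -/
def IsRangeState {C : Type*} [CStarAlgebra C] (D : StarSubalgebra ℂ C)
    (φ f : WeakDual ℂ C) : Prop :=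
  f ∈ modStates D ∧ ∀ v ∈ normalizers D, φ v ≠ 0 → ∀ x, φ (x * v) = f x * φ v

/-- The set of `F`-compatible eigenfunctionals: compatible eigenfunctionals of norm one whose
source state is in `F`.  It carries the relative weak-* topology. -/
def eigF {C : Type*} [CStarAlgebra C] (D : StarSubalgebra ℂ C) (F : Set (WeakDual ℂ C)) :
    Set (WeakDual ℂ C) :=
  {φ | IsCompatibleEigenfunctional D φ ∧ ‖WeakDual.toStrongDual φ‖ = 1 ∧
    ∃ f ∈ F, IsSourceState D φ f}

/-- The set of moduli `|φ| : x ↦ |φ(x)|` of `F`-compatible eigenfunctionals.  It carries the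
topology of pointwise convergence. -/
def specF {C : Type*} [CStarAlgebra C] (D : StarSubalgebra ℂ C) (F : Set (WeakDual ℂ C)) :
    Set (C → ℝ) :=
  {α | ∃ φ ∈ eigF D F, α = fun x => ‖φ x‖}

/-- The map `φ ↦ |φ|`. -/
noncomputable def modulus {C : Type*} [CStarAlgebra C] (D : StarSubalgebra ℂ C) (F : Set (WeakDual ℂ C))
    (φ : eigF D F) : specF D F :=
  ⟨fun x => ‖(φ : WeakDual ℂ C) x‖, φ, φ.2, rfl⟩

/-- The functional `[v, f] : x ↦ f(v* x) / f(v* v)^{1/2}`. -/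
noncomputable def bracket {C : Type*} [CStarAlgebra C] (v : C) (f : WeakDual ℂ C) (x : C) : ℂ :=
  f (star v * x) / ((√(f (star v * v)).re : ℝ) : ℂ)

/-- `E` is the groupoid structure of the set of `F`-compatible eigenfunctionals, where `s` and `r`
are the source and range state maps: `(φ, ψ)` is composable when `s(φ) = r(ψ)`, the product is
`φ ψ = [v w, s(ψ)]` for any normalizers `v`, `w` with `φ(v) > 0` and `ψ(w) > 0`, and
`φ⁻¹(x)` is the conjugate of `φ(x*)`.  Source and range in the groupoid are `s` and `r`. -/
structure IsEigGroupoid {C : Type*} [CStarAlgebra C] (D : StarSubalgebra ℂ C)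
    (F : Set (WeakDual ℂ C)) (E : SetGroupoid (eigF D F)) (s r : eigF D F → F) : Prop where
  isSourceState : ∀ φ : eigF D F, IsSourceState D (φ : WeakDual ℂ C) (s φ : WeakDual ℂ C)
  isRangeState : ∀ φ : eigF D F, IsRangeState D (φ : WeakDual ℂ C) (r φ : WeakDual ℂ C)
  comp_iff : ∀ φ ψ, E.Comp φ ψ ↔ s φ = r ψ
  mul_apply : ∀ φ ψ (h : E.Comp φ ψ), ∀ v ∈ normalizers D, ∀ w ∈ normalizers D,
    0 < (φ : WeakDual ℂ C) v → 0 < (ψ : WeakDual ℂ C) w →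
      ∀ x, (E.mul φ ψ h : WeakDual ℂ C) x = bracket (v * w) (s ψ : WeakDual ℂ C) x
  inv_apply : ∀ φ x, (E.inv φ : WeakDual ℂ C) x = conj ((φ : WeakDual ℂ C) (star x))
  source_eq : ∀ φ, (E.source φ : WeakDual ℂ C) = s φ
  range_eq : ∀ φ, (E.range φ : WeakDual ℂ C) = r φ

/-- `R` is the groupoid structure of the set of moduli of `F`-compatible eigenfunctionals that is
induced by `E`: `(|φ|, |ψ|)` is composable when `(φ, ψ)` is (for some representatives), with
product `|φ ψ|`, and `|φ|⁻¹ = |φ⁻¹|`. -/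
structure IsSpecGroupoid {C : Type*} [CStarAlgebra C] (D : StarSubalgebra ℂ C)
    (F : Set (WeakDual ℂ C)) (E : SetGroupoid (eigF D F)) (R : SetGroupoid (specF D F)) :
    Prop where
  comp_iff : ∀ α β, R.Comp α β ↔ ∃ φ ψ, modulus D F φ = α ∧ modulus D F ψ = β ∧ E.Comp φ ψ
  mul_eq : ∀ φ ψ (h : E.Comp φ ψ) (h' : R.Comp (modulus D F φ) (modulus D F ψ)),
    R.mul _ _ h' = modulus D F (E.mul φ ψ h)
  inv_eq : ∀ φ, R.inv (modulus D F φ) = modulus D F (E.inv φ)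

end RegIncl

open RegIncl

namespace RegIncl

variable {C : Type*} [CStarAlgebra C] {D : StarSubalgebra ℂ C} {F : Set (WeakDual ℂ C)}

/-! ### Normalizers -/

/-! An eigenfunctional is controlled by one normalizer at which it does not vanish. Dense span
supplies a normalizer `v` with φ(v) ≠ 0. If f = s(φ), compatibility says |φ(v)|² = f(v*v), and
computing φ(vv*x) in two ways gives φ(x)·conj φ(v) = f(v*x). This is `IsImplemented`: φ is a
unimodular multiple of [v, f].

Conversely, take f in F and a functional implemented by `v` over f. Equality in the Cauchy-Schwarz
inequality makes a compatible state multiplicative on D and at every normalizer where it is nonzero.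
Hence `v` may be exchanged for any normalizer `w` with φ(w) ≠ 0 (`IsImplemented.change`), which
yields compatibility and the source state. The norm is exactly one by a functional calculus argument
(`IsImplemented.norm_eq_one`). So membership in `eigF` always reduces to exhibiting an implementing
normalizer.

The inverse of φ is implemented by `v*` over the conjugated state f(v*·v)/f(v*v), which is in F by
invariance. The product satisfies (φψ)(x)·conj φ(v) = ψ(v*x) for every admissible `v`, and the
groupoid axioms follow from this identity. A state is determined by its modulus, so two
eigenfunctionals with equal modulus differ by a scalar in 𝕋, and all operations descend to moduli.

For the topology, fix `v`. On the open set of moduli not vanishing at `v`, the source map is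
injective with continuous inverse f ↦ |[v, f]|, hence a homeomorphism onto an open subset of the
compact space F. This gives local compactness, étaleness and bisections. The map α ↦ [v, s(α)] is a
continuous section there, and φ(v) divided by the value of the section at `v` is the circle
coordinate that trivialises the twist. -/

theorem mul_mem_normalizers {v w : C} (hv : v ∈ normalizers D) (hw : w ∈ normalizers D) :
    v * w ∈ normalizers D := by
  intro d hd
  have h₁ := (hw _ (hv d hd).1).1
  have h₂ := (hv _ (hw d hd).2).2
  simp only [star_mul, mul_assoc] at h₁ h₂ ⊢
  exact ⟨h₁, h₂⟩

theorem star_mem_normalizers {v : C} (hv : v ∈ normalizers D) : star v ∈ normalizers D := by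
  intro d hd
  have h := hv d hd
  rw [star_star]
  exact ⟨h.2, h.1⟩

theorem mem_normalizers_of_mem {d : C} (hd : d ∈ D) : d ∈ normalizers D :=
  fun _ he => ⟨mul_mem (mul_mem (star_mem hd) he) hd, mul_mem (mul_mem hd he) (star_mem hd)⟩

theorem one_mem_normalizers : (1 : C) ∈ normalizers D := mem_normalizers_of_mem (one_mem D)

theorem self_mul_star_mem {v : C} (hv : v ∈ normalizers D) : v * star v ∈ D := by
  simpa using star_mul_self_mem (star_mem_normalizers hv)

/-- Regularity enters here: a continuous functional that kills the normalizers kills their dense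
span. -/
theorem exists_normalizer_ne_zero (hD : IsRegularInclusion D) {φ : WeakDual ℂ C} (hφ : φ ≠ 0) :
    ∃ v ∈ normalizers D, φ v ≠ 0 := by
  by_contra! h
  apply hφ
  have h₁ : ∀ x ∈ Submodule.span ℂ (normalizers D), φ x = 0 := by
    intro x hx
    induction hx using Submodule.span_induction with
    | mem x hx => exact h x hx
    | zero => exact map_zero φ
    | add x y _ _ hx hy => rw [map_add, hx, hy, add_zero]
    | smul a x _ hx => rw [map_smul, hx, smul_zero]
  have h₂ : (φ : C → ℂ) = fun _ => 0 :=
    Continuous.ext_on hD.dense_span (map_continuous φ) continuous_const h₁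
  exact DFunLike.coe_injective h₂

/-! ### States -/

/-- A state, as a positive linear map for the spectral order. -/
theorem exists_positiveLinearMap {f : WeakDual ℂ C} (hf : f ∈ states C) :
    letI := CStarAlgebra.spectralOrder C
    ∃ g : C →ₚ[ℂ] ℂ, ∀ x, g x = f x := by
  let := CStarAlgebra.spectralOrder C
  have := CStarAlgebra.spectralOrderedRing C
  refine ⟨PositiveLinearMap.mk₀ (WeakDual.toStrongDual f).toLinearMap ?_, fun x => rfl⟩
  intro x hx
  obtain ⟨y, rfl⟩ := CStarAlgebra.nonneg_iff_eq_star_mul_self.mp hx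
  exact hf.1 y

theorem map_star_of_state {f : WeakDual ℂ C} (hf : f ∈ states C) (x : C) :
    f (star x) = conj (f x) := by
  let := CStarAlgebra.spectralOrder C
  have := CStarAlgebra.spectralOrderedRing C
  obtain ⟨g, hg⟩ := exists_positiveLinearMap hf
  rw [← hg, ← hg, map_star]; rfl

/-- Cauchy-Schwarz inequality for the pre-GNS inner product of the state. -/
theorem norm_sq_le_of_state {f : WeakDual ℂ C} (hf : f ∈ states C) (x y : C) :
    ‖f (star x * y)‖ ^ 2 ≤ (f (star x * x)).re * (f (star y * y)).re := by
  let := CStarAlgebra.spectralOrder C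
  have := CStarAlgebra.spectralOrderedRing C
  obtain ⟨g, hg⟩ := exists_positiveLinearMap hf
  have h := norm_inner_le_norm (𝕜 := ℂ) (g.toPreGNS x) (g.toPreGNS y)
  rw [g.preGNS_inner_def, g.preGNS_norm_def, g.preGNS_norm_def] at h
  simp only [PositiveLinearMap.ofPreGNS_toPreGNS, hg] at h
  have h₂ := pow_le_pow_left₀ (norm_nonneg _) h 2
  rwa [mul_pow, Real.sq_sqrt (Complex.nonneg_iff.mp (hf.1 x)).1,
    Real.sq_sqrt (Complex.nonneg_iff.mp (hf.1 y)).1] at h₂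

theorem state_star_mul_self {f : WeakDual ℂ C} (hf : f ∈ states C) (x : C) :
    f (star x * x) = ((f (star x * x)).re : ℂ) :=
  Complex.eq_re_of_ofReal_le (r := 0) (by simpa using hf.1 x)

theorem state_star_mul_self_le {f : WeakDual ℂ C} (hf : f ∈ states C) (x : C) :
    (f (star x * x)).re ≤ ‖x‖ ^ 2 := by
  let := CStarAlgebra.spectralOrder C
  have := CStarAlgebra.spectralOrderedRing C
  obtain ⟨g, hg⟩ := exists_positiveLinearMap hf
  have h := OrderHomClass.mono g (CStarAlgebra.star_mul_le_algebraMap_norm_sq (a := x))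
  rw [hg, hg, Algebra.algebraMap_eq_smul_one, ← Complex.coe_smul, map_smul, hf.2] at h
  simpa [← Complex.ofReal_pow] using (Complex.le_def.mp h).1

theorem norm_le_of_state {f : WeakDual ℂ C} (hf : f ∈ states C) (x : C) : ‖f x‖ ≤ ‖x‖ := by
  have h := norm_sq_le_of_state hf 1 x
  have h₂ := state_star_mul_self_le hf x
  simp only [star_one, one_mul, hf.2, Complex.one_re] at h
  exact le_of_sq_le_sq (h.trans h₂) (norm_nonneg _)

/-- Elements at which equality holds in the Cauchy-Schwarz inequality are multiplicative. -/
theorem state_mul_of_eq {f : WeakDual ℂ C} (hf : f ∈ states C) {u : C}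
    (hu : f (u * star u) = f u * conj (f u)) (x : C) : f (u * x) = f u * f x := by
  -- The hypothesis says f(a*a) = 0 for this element, so Cauchy-Schwarz forces f(a*x) = 0, where a*
  -- = u − f(u)1.
  set a : C := star u - (conj (f u)) • (1 : C) with ha
  have h₀ : f (star a * a) = 0 := by
    simp [ha, sub_mul, mul_sub, map_star_of_state hf, hu, hf.2]
  have h₁ := norm_sq_le_of_state hf a x
  rw [h₀, Complex.zero_re, zero_mul] at h₁
  have h₂ : f (star a * x) = 0 := by
    rw [← norm_eq_zero]; exact pow_eq_zero_iff (two_ne_zero) |>.mp (le_antisymm h₁ (by positivity))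
  simpa [ha, sub_mul, sub_eq_zero] using h₂

theorem state_mul_right_of_eq {f : WeakDual ℂ C} (hf : f ∈ states C) {u : C}
    (hu : f (star u * u) = f u * conj (f u)) (x : C) : f (x * u) = f x * f u := by
  have h := state_mul_of_eq hf (u := star u)
    (by rw [star_star, hu, map_star_of_state hf, Complex.conj_conj, mul_comm]) (star x)
  rw [← star_mul, map_star_of_state hf, map_star_of_state hf, map_star_of_state hf, ← map_mul] at h
  rw [(starRingEnd ℂ).injective h, mul_comm]

/-! ### Compatible states -/

theorem ofReal_norm_sq (z : ℂ) : ((‖z‖ ^ 2 : ℝ) : ℂ) = z * conj z := by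
  rw [Complex.mul_conj, Complex.normSq_eq_norm_sq]

/-- Compatibility at `u*` reads f(uu*) = |f(u)|², the case of equality in Cauchy-Schwarz. -/
theorem compatible_mul {f : WeakDual ℂ C} (hf : f ∈ compatibleStates D) {u : C}
    (hu : u ∈ normalizers D) (h : f u ≠ 0) (x : C) : f (u * x) = f u * f x := by
  refine state_mul_of_eq hf.1 ?_ x
  have h₁ := hf.2 _ (star_mem_normalizers hu)
  rw [map_star_of_state hf.1, star_star, ofReal_norm_sq, Complex.conj_conj] at h₁
  rcases h₁ with h₁ | h₁
  · exact absurd ((map_eq_zero _).mp h₁) h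
  · rw [← h₁, mul_comm]

theorem compatible_mul_right {f : WeakDual ℂ C} (hf : f ∈ compatibleStates D) {u : C}
    (hu : u ∈ normalizers D) (h : f u ≠ 0) (x : C) : f (x * u) = f x * f u := by
  refine state_mul_right_of_eq hf.1 ?_ x
  rcases hf.2 _ hu with h₁ | h₁
  · exact absurd h₁ h
  · rw [← h₁, ofReal_norm_sq]

theorem compatible_mul_mem {f : WeakDual ℂ C} (hf : f ∈ compatibleStates D) {d : C} (hd : d ∈ D)
    (x : C) : f (d * x) = f d * f x := by
  by_cases h : f d = 0
  -- Multiplicativity at a normalizer needs a nonzero value; shifting `d` by the unit gives the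
  -- value 1 and stays in D.
  · have h₁ := compatible_mul hf (u := d + 1)
      (mem_normalizers_of_mem (add_mem hd (one_mem D))) (by simp [h, hf.1.2]) x
    simpa [add_mul, h, hf.1.2] using h₁
  · exact compatible_mul hf (mem_normalizers_of_mem hd) h x

theorem compatible_mul_mem_right {f : WeakDual ℂ C} (hf : f ∈ compatibleStates D) {d : C}
    (hd : d ∈ D) (x : C) : f (x * d) = f x * f d := by
  by_cases h : f d = 0
  · have h₁ := compatible_mul_right hf (u := d + 1)
      (mem_normalizers_of_mem (add_mem hd (one_mem D))) (by simp [h, hf.1.2]) x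
    simpa [mul_add, h, hf.1.2] using h₁
  · exact compatible_mul_right hf (mem_normalizers_of_mem hd) h x

/-- The restriction of a compatible state to `D` is a character. -/
theorem exists_character {f : WeakDual ℂ C} (hf : f ∈ compatibleStates D) :
    ∃ σ : WeakDual.characterSpace ℂ D, ∀ d : D, f d = σ d := by
  let g : WeakDual ℂ D := StrongDual.toWeakDual
    { toFun := fun d => f d
      map_add' := fun a b => by simp
      map_smul' := fun a b => by simp
      cont := (map_continuous f).comp continuous_subtype_val }
  have hg : ∀ d : D, g d = f d := fun d => rfl
  have h : g ∈ WeakDual.characterSpace ℂ D := by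
    rw [WeakDual.CharacterSpace.eq_set_map_one_map_mul]
    exact ⟨hf.1.2, fun x y => compatible_mul_mem hf x.2 _⟩
  exact ⟨⟨g, h⟩, fun d => rfl⟩

theorem compatible_mem_modStates {f : WeakDual ℂ C} (hf : f ∈ compatibleStates D) :
    f ∈ modStates D := ⟨hf.1, exists_character hf⟩

/-- The functional `f(v* ·)` is an eigenvector for the left action of `D`. -/
theorem compatible_left_eigen (hD : IsRegularInclusion D) {f : WeakDual ℂ C}
    (hf : f ∈ compatibleStates D) {v : C} (hv : v ∈ normalizers D) {d : C} (hd : d ∈ D) (x : C) :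
    f (star v * v) * f (star v * (d * x)) = f (star v * d * v) * f (star v * x) := by
  rw [← compatible_mul_mem hf (star_mul_self_mem hv), ← compatible_mul_mem hf (hv d hd).1]
  congr 1
  -- Commutativity of D lets `d` pass vv*, which also lies in D.
  have h := hD.comm _ (self_mul_star_mem hv) _ hd
  calc star v * v * (star v * (d * x)) = star v * (v * star v * d) * x := by simp only [mul_assoc]
    _ = star v * d * v * (star v * x) := by rw [h]; simp only [mul_assoc]

/-! ### Eigenfunctionals -/

/-- `φ` is a scalar multiple of `f(v* ·)`, normalised so that `|φ(v)|² = f(v* v)`. -/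
def IsImplemented (φ f : WeakDual ℂ C) (v : C) : Prop :=
  φ v ≠ 0 ∧ ∀ x, φ x * conj (φ v) = f (star v * x)

namespace IsImplemented

variable {φ f : WeakDual ℂ C} {v w : C}

theorem conj_ne_zero (h : IsImplemented φ f v) : conj (φ v) ≠ 0 := (map_ne_zero _).mpr h.1

theorem star_mul_self (h : IsImplemented φ f v) : f (star v * v) = φ v * conj (φ v) :=
  (h.2 v).symm

theorem star_mul_self_ne_zero (h : IsImplemented φ f v) : f (star v * v) ≠ 0 := by
  rw [h.star_mul_self]; exact mul_ne_zero h.1 h.conj_ne_zero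

theorem mul_left (hf : f ∈ compatibleStates D) (hv : v ∈ normalizers D)
    (h : IsImplemented φ f v) (x : C) : φ (v * x) = φ v * f x := by
  apply mul_right_cancel₀ h.conj_ne_zero
  rw [h.2, ← mul_assoc, compatible_mul_mem hf (star_mul_self_mem hv), h.star_mul_self]
  ring

theorem mul_right_mem (hf : f ∈ compatibleStates D) (h : IsImplemented φ f v) {d : C}
    (hd : d ∈ D) (x : C) : φ (x * d) = φ x * f d := by
  apply mul_right_cancel₀ h.conj_ne_zero
  rw [h.2, ← mul_assoc, compatible_mul_mem_right hf hd, ← h.2]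
  ring

theorem mul_left_mem (hD : IsRegularInclusion D) (hf : f ∈ compatibleStates D)
    (hv : v ∈ normalizers D) (h : IsImplemented φ f v) {d : C} (hd : d ∈ D) (x : C) :
    f (star v * v) * φ (d * x) = f (star v * d * v) * φ x := by
  apply mul_right_cancel₀ h.conj_ne_zero
  rw [mul_assoc, h.2, mul_assoc, h.2, compatible_left_eigen hD hf hv hd]

/-- The left eigenvalues can be computed from any normalizer on which `φ` does not vanish. -/
theorem conjugate_eq (hD : IsRegularInclusion D) (hf : f ∈ compatibleStates D)
    (hv : v ∈ normalizers D) (h : IsImplemented φ f v) (hw : w ∈ normalizers D) (hφ : φ w ≠ 0)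
    {d : C} (hd : d ∈ D) : f (star v * v) * f (star w * d * w) =
      f (star v * d * v) * f (star w * w) := by
  -- With λ(d) the left eigenvalue of φ at `d`, evaluate φ(ww*dw): it is λ(ww*)λ(d)φ(w), and also
  -- φ(w)f(w*dw) because w*dw is in D. The case d = 1 gives λ(ww*) = f(w*w), so f(w*dw) =
  -- λ(d)f(w*w).
  have h₁ := h.mul_left_mem hD hf hv hd w
  have h₂ := h.mul_left_mem hD hf hv (self_mul_star_mem hw) w
  have e₁ : φ (w * star w * w) = φ w * f (star w * w) := by
    rw [mul_assoc, h.mul_right_mem hf (star_mul_self_mem hw)]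
  have e₂ : φ (w * star w * d * w) = φ w * f (star w * d * w) := by
    rw [show w * star w * d * w = w * (star w * d * w) by simp only [mul_assoc],
      h.mul_right_mem hf (hw d hd).1]
  have e₃ := h.mul_left_mem hD hf hv (self_mul_star_mem hw) (d * w)
  rw [← mul_assoc, e₂] at e₃
  rw [e₁] at h₂
  apply mul_left_cancel₀ hφ
  apply mul_left_cancel₀ h.star_mul_self_ne_zero
  linear_combination f (star v * v) * e₃ + f (star v * (w * star w) * v) * h₁ -
    f (star v * d * v) * h₂

/-- The implementing normalizer may be changed. -/
theorem change (hD : IsRegularInclusion D) (hf : f ∈ compatibleStates D)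
    (hv : v ∈ normalizers D) (h : IsImplemented φ f v) (hw : w ∈ normalizers D) (hφ : φ w ≠ 0) :
    IsImplemented φ f w := by
  refine ⟨hφ, fun x => ?_⟩
  have h₀ : f (star w * v) ≠ 0 := by
    rw [← star_star v, ← star_mul, map_star_of_state hf.1, ← h.2]
    exact (map_ne_zero _).mpr (mul_ne_zero hφ h.conj_ne_zero)
  -- Evaluate f(w*vv*x) twice: by multiplicativity at the normalizer w*v, and by the eigenvector
  -- property of f(w*·) for vv* in D. The eigenvalue in the second is f(v*v), by `conjugate_eq` in
  -- `h₃`.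
  have h₁ := compatible_mul hf (mul_mem_normalizers (star_mem_normalizers hw) hv) h₀ (star v * x)
  have h₂ := compatible_left_eigen hD hf hw (self_mul_star_mem hv) x
  have h₃ := h.conjugate_eq hD hf hv hw hφ (self_mul_star_mem hv)
  have h₄ : f (star v * (v * star v) * v) = f (star v * v) * f (star v * v) := by
    rw [← compatible_mul_mem hf (star_mul_self_mem hv)]; simp only [mul_assoc]
  have h₅ : f (star w * v) = conj (φ w) * φ v := by
    rw [← star_star v, ← star_mul, map_star_of_state hf.1, ← h.2, star_star, map_mul,
      Complex.conj_conj]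
  have h₆ : f (star w * w) ≠ 0 := by
    intro h₆
    have := norm_sq_le_of_state hf.1 w v
    rw [h₆, Complex.zero_re, zero_mul] at this
    exact h₀ (norm_eq_zero.mp (pow_eq_zero_iff (two_ne_zero) |>.mp
      (le_antisymm this (by positivity))))
  have h₇ : f (star w * (v * star v) * w) = f (star v * v) * f (star w * w) := by
    apply mul_left_cancel₀ h.star_mul_self_ne_zero
    rw [h₃, h₄]; ring
  have h₈ : f (star w * (v * star v * x)) = f (star w * v) * f (star v * x) := by
    rw [← h₁]; simp only [mul_assoc]
  rw [h₇, h₈, h₅, ← h.2] at h₂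
  apply mul_left_cancel₀ (mul_ne_zero h₆ h.star_mul_self_ne_zero)
  rw [h.star_mul_self] at h₂ ⊢
  linear_combination h₂

theorem source_eq (hD : IsRegularInclusion D) (hf : f ∈ compatibleStates D)
    (hv : v ∈ normalizers D) (h : IsImplemented φ f v) : IsSourceState D φ f :=
  ⟨compatible_mem_modStates hf, fun _ hw hφ => (h.change hD hf hv hw hφ).mul_left hf hw⟩

theorem norm_apply_le (hf : f ∈ states C) (h : IsImplemented φ f v) (x : C) : ‖φ x‖ ≤ ‖x‖ := by
  have h₁ := norm_sq_le_of_state hf v x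
  have h₂ := state_star_mul_self_le hf x
  have h₃ : (f (star v * v)).re = ‖φ v‖ ^ 2 := by
    rw [h.star_mul_self, ← ofReal_norm_sq, Complex.ofReal_re]
  rw [← h.2, norm_mul, RCLike.norm_conj, h₃, mul_pow, mul_comm] at h₁
  have h₄ : (0 : ℝ) < ‖φ v‖ ^ 2 := by have := norm_pos_iff.mpr h.1; positivity
  exact le_of_sq_le_sq ((le_of_mul_le_mul_left h₁ h₄).trans h₂) (norm_nonneg _)

end IsImplemented

/-- For a positive element `v* v` and `c > 0` there is a positive element `h` with
`(v* v + c²) h = 2 c` and `‖v h‖ ≤ 1`. -/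
theorem exists_norm_mul_le_one (v : C) {c : ℝ} (hc : 0 < c) :
    ∃ h : C, star v * v * h + ((c ^ 2 : ℝ) : ℂ) • h = ((2 * c : ℝ) : ℂ) • 1 ∧ ‖v * h‖ ≤ 1 := by
  let := CStarAlgebra.spectralOrder C
  have := CStarAlgebra.spectralOrderedRing C
  set a : C := star v * v with ha
  have ha₀ : 0 ≤ a := star_mul_self_nonneg v
  have hsa : IsSelfAdjoint a := IsSelfAdjoint.star_mul_self v
  have hpos : ∀ t ∈ spectrum ℝ a, 0 ≤ t := fun t ht => spectrum_nonneg_of_nonneg ha₀ ht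
  -- With h = g(v*v), the norm of vh is governed by t·g(t)² ≤ 1. This is 4c²t ≤ (t + c²)², with
  -- equality at t = c², the value relevant when f(v*v) = c².
  set g : ℝ → ℝ := fun t => 2 * c / (t + c ^ 2) with hg
  have hne : ∀ t ∈ spectrum ℝ a, t + c ^ 2 ≠ 0 := fun t ht => by
    have := hpos t ht; positivity
  have hgc : ContinuousOn g (spectrum ℝ a) :=
    ContinuousOn.div continuousOn_const (by fun_prop) hne
  have hstar : star (cfc g a) = cfc g a := (cfc_predicate g a : IsSelfAdjoint _)
  refine ⟨cfc g a, ?_, ?_⟩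
  · have h₁ : a * cfc g a = cfc (fun t => t * g t) a := by
      rw [cfc_mul (fun t => t) g a (by fun_prop) hgc, cfc_id' ℝ a]
    have h₂ : ((c ^ 2 : ℝ) : ℂ) • cfc g a = cfc (fun t => c ^ 2 * g t) a := by
      rw [cfc_const_mul (c ^ 2) g a hgc, Complex.coe_smul]
    rw [h₁, h₂, ← cfc_add (a := a) (fun t => t * g t) (fun t => c ^ 2 * g t)
      (by fun_prop) (by fun_prop)]
    rw [cfc_congr (g := fun _ => 2 * c) (fun t ht => ?_), cfc_const (2 * c) a,
      Algebra.algebraMap_eq_smul_one, Complex.coe_smul]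
    have := hne t ht
    simp only [hg]; field_simp
  · rw [← sq_le_one_iff₀ (norm_nonneg _), sq, ← CStarRing.norm_star_mul_self]
    have h₁ : star (v * cfc g a) * (v * cfc g a) = cfc (fun t => g t * t * g t) a := by
      rw [cfc_mul (fun t => g t * t) g a (by fun_prop) hgc,
        cfc_mul g (fun t => t) a hgc (by fun_prop), cfc_id' ℝ a, star_mul, hstar, ha]
      simp only [mul_assoc]
    rw [h₁]
    refine norm_cfc_le zero_le_one fun t ht => ?_
    have h₀ := hpos t ht
    rw [Real.norm_of_nonneg (by positivity)]
    simp only [hg]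
    rw [div_mul_eq_mul_div, div_mul_div_comm, div_le_one (by positivity)]
    nlinarith [sq_nonneg (t - c ^ 2)]

/-! ### Implemented functionals are compatible eigenfunctionals of norm one -/

namespace IsImplemented

variable {φ f : WeakDual ℂ C} {v : C}

/-- Since ‖v‖ may exceed |φ(v)| = c, the element `v` itself need not show that the norm is attained.
Applying f to the relation for `k` gives 2c²f(k) = 2c, so f(k) = 1/c and |φ(vk)| = 1 with ‖vk‖ ≤ 1.
-/
theorem norm_eq_one (hf : f ∈ compatibleStates D) (hv : v ∈ normalizers D)
    (h : IsImplemented φ f v) : ‖WeakDual.toStrongDual φ‖ = 1 := by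
  apply le_antisymm
  · exact ContinuousLinearMap.opNorm_le_bound _ zero_le_one
      (fun x => by rw [one_mul]; exact h.norm_apply_le hf.1 x)
  · have hc : 0 < ‖φ v‖ := norm_pos_iff.mpr h.1
    obtain ⟨k, hk, hk₁⟩ := exists_norm_mul_le_one v hc
    have h₁ := congrArg f hk
    rw [map_add, compatible_mul_mem hf (star_mul_self_mem hv), map_smul, map_smul, hf.1.2,
      smul_eq_mul, smul_eq_mul, h.star_mul_self, ← ofReal_norm_sq] at h₁
    have hc' : ((‖φ v‖ : ℝ) : ℂ) ≠ 0 := by exact_mod_cast hc.ne'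
    have h₂ : ((‖φ v‖ : ℝ) : ℂ) * f k = 1 := by
      apply mul_left_cancel₀ (mul_ne_zero two_ne_zero hc')
      push_cast at h₁
      linear_combination h₁
    have h₃ : ‖φ (v * k)‖ = 1 := by
      rw [h.mul_left hf hv]
      simpa using congrArg norm h₂
    calc (1 : ℝ) = ‖WeakDual.toStrongDual φ (v * k)‖ := h₃.symm
      _ ≤ ‖WeakDual.toStrongDual φ‖ * ‖v * k‖ := ContinuousLinearMap.le_opNorm _ _
      _ ≤ ‖WeakDual.toStrongDual φ‖ := mul_le_of_le_one_right (norm_nonneg _) hk₁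

/-- Compatibility at an arbitrary `w` holds because `w` itself implements φ as soon as φ(w) ≠ 0. -/
theorem isCompatibleEigenfunctional (hD : IsRegularInclusion D) (hf : f ∈ compatibleStates D)
    (hv : v ∈ normalizers D) (h : IsImplemented φ f v) : IsCompatibleEigenfunctional D φ := by
  obtain ⟨σ, hσ⟩ := exists_character hf
  refine ⟨⟨?_, ?_, ?_⟩, σ, ?_, ?_⟩
  · intro h₀
    exact h.1 (by rw [h₀]; rfl)
  · intro d hd
    refine ⟨f (star v * d * v) / f (star v * v), fun x => ?_⟩
    rw [div_mul_eq_mul_div, ← h.mul_left_mem hD hf hv hd,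
      mul_div_cancel_left₀ _ h.star_mul_self_ne_zero]
  · exact fun d hd => ⟨f d, fun x => by rw [h.mul_right_mem hf hd, mul_comm]⟩
  · intro x d
    rw [h.mul_right_mem hf d.2, hσ]
  · intro w hw
    by_cases hφ : φ w = 0
    · exact Or.inl hφ
    · right
      rw [← hσ, (h.change hD hf hv hw hφ).star_mul_self, ofReal_norm_sq]

theorem mem_eigF (hD : IsRegularInclusion D) (hF : IsCompatibleCover D F) (hf : f ∈ F)
    (hv : v ∈ normalizers D) (h : IsImplemented φ f v) : φ ∈ eigF D F :=
  ⟨h.isCompatibleEigenfunctional hD (hF.subset hf) hv, h.norm_eq_one (hF.subset hf) hv, f, hf,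
    h.source_eq hD (hF.subset hf) hv⟩

end IsImplemented

/-- An eigenfunctional is implemented by each normalizer on which it does not vanish. -/
theorem isImplemented_of_isSourceState {φ f : WeakDual ℂ C}
    (hφ : IsCompatibleEigenfunctional D φ) (hs : IsSourceState D φ f) {v : C}
    (hv : v ∈ normalizers D) (h₀ : φ v ≠ 0) : IsImplemented φ f v := by
  obtain ⟨⟨-, hl, -⟩, σ, hσ, hc⟩ := hφ
  refine ⟨h₀, fun x => ?_⟩
  have h₁ := (hc v hv).resolve_left h₀
  -- The left eigenvalue of vv*, read off at `v`, is σ(v*v) = |φ(v)|². Then φ(vv*x) equals both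
  -- |φ(v)|²φ(x) and φ(v)f(v*x).
  obtain ⟨c, hc⟩ := hl _ (self_mul_star_mem hv)
  have h₂ : c = φ v * conj (φ v) := by
    rw [← ofReal_norm_sq, h₁]
    apply mul_right_cancel₀ h₀
    rw [← hc, mul_assoc, mul_comm _ (φ v)]
    exact hσ v ⟨star v * v, star_mul_self_mem hv⟩
  apply mul_left_cancel₀ h₀
  rw [← hs.2 v hv h₀, ← mul_assoc v, hc, h₂]
  ring

/-! ### The groupoid of eigenfunctionals -/

theorem SetGroupoid.source_inv {X : Type*} (G : SetGroupoid X) (a : X) :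
    G.source (G.inv a) = G.range a :=
  (G.mul_congr (G.inv_inv a) rfl (G.inv_comp (G.inv a))).2

/-- Positivity of φ(v) fixes the phase: the root of f(v*v) = |φ(v)|² is φ(v) itself. -/
theorem IsImplemented.apply_eq_bracket {φ f : WeakDual ℂ C} {v : C} (h : IsImplemented φ f v)
    (hpos : 0 < φ v) (x : C) : φ x = bracket v f x := by
  obtain ⟨hre, him⟩ := Complex.pos_iff.mp hpos
  have h₁ : φ v = ((φ v).re : ℂ) := Complex.ext rfl (by simp [← him])
  have h₂ : conj (φ v) = φ v := by rw [h₁, Complex.conj_ofReal]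
  have h₃ : √(f (star v * v)).re = (φ v).re := by
    rw [h.star_mul_self, h₂, h₁, ← Complex.ofReal_mul, Complex.ofReal_re, Complex.ofReal_re,
      Real.sqrt_mul_self hre.le]
  rw [bracket, h₃, ← h₁, ← h.2, h₂, mul_div_cancel_right₀ _ h.1]

theorem eigF_ext {φ ψ : eigF D F}
    (h : ∀ x, (φ : WeakDual ℂ C) x = (ψ : WeakDual ℂ C) x) : φ = ψ :=
  Subtype.ext (DFunLike.ext _ _ h)

theorem exists_apply_ne_zero (hD : IsRegularInclusion D) (φ : eigF D F) :
    ∃ v ∈ normalizers D, (φ : WeakDual ℂ C) v ≠ 0 :=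
  exists_normalizer_ne_zero hD φ.2.1.1.1

/-- The source state of an eigenfunctional. -/
noncomputable def src (φ : eigF D F) : F := ⟨φ.2.2.2.choose, φ.2.2.2.choose_spec.1⟩

theorem src_isSourceState (φ : eigF D F) : IsSourceState D (φ : WeakDual ℂ C) (src φ) :=
  φ.2.2.2.choose_spec.2

theorem apply_mul_left (φ : eigF D F) {v : C} (hv : v ∈ normalizers D)
    (h : (φ : WeakDual ℂ C) v ≠ 0) (x : C) :
    (φ : WeakDual ℂ C) (v * x) = (φ : WeakDual ℂ C) v * (src φ : WeakDual ℂ C) x :=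
  (src_isSourceState φ).2 v hv h x

theorem isImplemented_src (φ : eigF D F) {v : C} (hv : v ∈ normalizers D)
    (h : (φ : WeakDual ℂ C) v ≠ 0) : IsImplemented (φ : WeakDual ℂ C) (src φ) v :=
  isImplemented_of_isSourceState φ.2.1 (src_isSourceState φ) hv h

theorem src_eq {φ : eigF D F} {f : F} {v : C} (hv : v ∈ normalizers D)
    (h : (φ : WeakDual ℂ C) v ≠ 0)
    (hf : ∀ x, (φ : WeakDual ℂ C) (v * x) = (φ : WeakDual ℂ C) v * (f : WeakDual ℂ C) x) :
    src φ = f := by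
  refine Subtype.ext (DFunLike.ext _ _ fun x => ?_)
  apply mul_left_cancel₀ h
  rw [← apply_mul_left φ hv h, hf]

/-- The functional `x ↦ conj (φ (x*))`. -/
noncomputable def starDual (φ : WeakDual ℂ C) : WeakDual ℂ C :=
  StrongDual.toWeakDual
    { toFun := fun x => conj (φ (star x))
      map_add' := fun a b => by simp
      map_smul' := fun a b => by simp
      cont := Complex.continuous_conj.comp ((map_continuous φ).comp continuous_star) }

@[simp] theorem starDual_apply (φ : WeakDual ℂ C) (x : C) : starDual φ x = conj (φ (star x)) := rfl

/-- The functional `x ↦ c φ(a x)`. -/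
noncomputable def translate (c : ℂ) (a : C) (φ : WeakDual ℂ C) : WeakDual ℂ C :=
  StrongDual.toWeakDual
    { toFun := fun x => c * φ (a * x)
      map_add' := fun x y => by simp [mul_add]
      map_smul' := fun z x => by
        simp only [mul_smul_comm, map_smul, smul_eq_mul, RingHom.id_apply]; ring
      cont := continuous_const.mul ((map_continuous φ).comp (continuous_const.mul continuous_id)) }

@[simp] theorem translate_apply (c : ℂ) (a : C) (φ : WeakDual ℂ C) (x : C) :
    translate c a φ x = c * φ (a * x) := rfl

/-- If `v` implements φ over f, then `v*` implements the adjoint over f(v*·v)/f(v*v). Invariance of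
the cover puts this state in F. -/
theorem starDual_mem (hD : IsRegularInclusion D) (hF : IsCompatibleCover D F) (φ : eigF D F) :
    starDual (φ : WeakDual ℂ C) ∈ eigF D F := by
  obtain ⟨v, hv, h⟩ := exists_apply_ne_zero hD φ
  have hi := isImplemented_src φ hv h
  have hf := hF.subset (src φ).2
  have h₀ := hi.star_mul_self_ne_zero
  obtain ⟨g, hg, hgx⟩ := hF.invariant v hv _ (src φ).2
    (lt_of_le_of_ne (hf.1.1 v) h₀.symm)
  refine IsImplemented.mem_eigF hD hF hg (star_mem_normalizers hv) ⟨by simpa using h, fun x => ?_⟩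
  have h₁ := congrArg conj (hi.2 (star x))
  rw [← star_mul, map_star_of_state hf.1, map_mul, Complex.conj_conj, Complex.conj_conj] at h₁
  rw [starDual_apply, starDual_apply, star_star, Complex.conj_conj, h₁, hgx, eq_div_iff h₀,
    show star v * (v * x) * v = star v * v * (x * v) by simp only [mul_assoc],
    compatible_mul_mem hf (star_mul_self_mem hv), mul_comm]

/-- The inverse of an eigenfunctional. -/
noncomputable def eigInv (hD : IsRegularInclusion D) (hF : IsCompatibleCover D F) (φ : eigF D F) :
    eigF D F := ⟨starDual (φ : WeakDual ℂ C), starDual_mem hD hF φ⟩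

/-- The range state of an eigenfunctional. -/
noncomputable def rng (hD : IsRegularInclusion D) (hF : IsCompatibleCover D F) (φ : eigF D F) :
    F := src (eigInv hD hF φ)

/-! ### Range states, the product, and the groupoid axioms -/

section Operations

variable (hD : IsRegularInclusion D) (hF : IsCompatibleCover D F)

@[simp] theorem eigInv_apply (φ : eigF D F) (x : C) :
    (eigInv hD hF φ : WeakDual ℂ C) x = conj ((φ : WeakDual ℂ C) (star x)) := rfl

theorem eigInv_eigInv (φ : eigF D F) : eigInv hD hF (eigInv hD hF φ) = φ :=
  eigF_ext fun x => by simp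

theorem rng_eigInv (φ : eigF D F) : rng hD hF (eigInv hD hF φ) = src φ := by
  rw [rng, eigInv_eigInv]

theorem state_compatible (hF : IsCompatibleCover D F) (f : F) :
    (f : WeakDual ℂ C) ∈ compatibleStates D := hF.subset f.2

/-- The adjoint of the source identity for φ⁻¹ at `v*`. -/
theorem apply_mul_right (φ : eigF D F) {v : C} (hv : v ∈ normalizers D)
    (h : (φ : WeakDual ℂ C) v ≠ 0) (x : C) :
    (φ : WeakDual ℂ C) (x * v) = (rng hD hF φ : WeakDual ℂ C) x * (φ : WeakDual ℂ C) v := by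
  have h₁ := apply_mul_left (eigInv hD hF φ) (star_mem_normalizers hv) (by simpa using h) (star x)
  rw [eigInv_apply, eigInv_apply, ← star_mul, star_star, star_star, ← rng,
    map_star_of_state (state_compatible hF _).1, ← map_mul] at h₁
  rw [(starRingEnd ℂ).injective h₁, mul_comm]

theorem rng_eq {φ : eigF D F} {f : F} {v : C} (hv : v ∈ normalizers D)
    (h : (φ : WeakDual ℂ C) v ≠ 0)
    (hf : ∀ x, (φ : WeakDual ℂ C) (x * v) = (f : WeakDual ℂ C) x * (φ : WeakDual ℂ C) v) :
    rng hD hF φ = f := by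
  refine Subtype.ext (DFunLike.ext _ _ fun x => ?_)
  apply mul_right_cancel₀ h
  rw [← apply_mul_right hD hF φ hv h, hf]

theorem rng_isRangeState (φ : eigF D F) : IsRangeState D (φ : WeakDual ℂ C) (rng hD hF φ) :=
  ⟨compatible_mem_modStates (state_compatible hF _),
    fun _ hv h => apply_mul_right hD hF φ hv h⟩

theorem apply_mul_mem (hD : IsRegularInclusion D) (hF : IsCompatibleCover D F) (φ : eigF D F)
    {d : C} (hd : d ∈ D) (x : C) :
    (φ : WeakDual ℂ C) (x * d) = (φ : WeakDual ℂ C) x * (src φ : WeakDual ℂ C) d := by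
  obtain ⟨v, hv, h⟩ := exists_apply_ne_zero hD φ
  exact (isImplemented_src φ hv h).mul_right_mem (state_compatible hF _) hd x

theorem apply_mem_mul (φ : eigF D F) {d : C} (hd : d ∈ D) (x : C) :
    (φ : WeakDual ℂ C) (d * x) = (rng hD hF φ : WeakDual ℂ C) d * (φ : WeakDual ℂ C) x := by
  have h₁ := apply_mul_mem hD hF (eigInv hD hF φ) (star_mem hd) (star x)
  rw [eigInv_apply, eigInv_apply, ← star_mul, star_star, star_star, ← rng,
    map_star_of_state (state_compatible hF _).1, ← map_mul] at h₁
  rw [(starRingEnd ℂ).injective h₁, mul_comm]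

/-- A normalizer on which `φ` does not vanish. -/
noncomputable def eigNormalizer (φ : eigF D F) : C := (exists_apply_ne_zero hD φ).choose

theorem eigNormalizer_mem (φ : eigF D F) : eigNormalizer hD φ ∈ normalizers D :=
  (exists_apply_ne_zero hD φ).choose_spec.1

theorem apply_eigNormalizer (φ : eigF D F) : (φ : WeakDual ℂ C) (eigNormalizer hD φ) ≠ 0 :=
  (exists_apply_ne_zero hD φ).choose_spec.2

variable {φ ψ : eigF D F} {v w : C}

/-- Both sides come from ψ(v*xw*w), computed once through the source of ψ at w*w and once through
its range at `w`, which is the source of φ. Consequently ψ(v*x)/conj φ(v) does not depend on `v`. -/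
theorem apply_star_mul_comp (hφψ : src φ = rng hD hF ψ) (hv : v ∈ normalizers D)
    (h : (φ : WeakDual ℂ C) v ≠ 0) (hw : w ∈ normalizers D) (h' : (ψ : WeakDual ℂ C) w ≠ 0)
    (x : C) : (ψ : WeakDual ℂ C) (star v * x) * conj ((ψ : WeakDual ℂ C) w) =
      conj ((φ : WeakDual ℂ C) v) * (φ : WeakDual ℂ C) (x * star w) := by
  have h₁ := (isImplemented_src φ hv h).2 (x * star w)
  have h₂ := apply_mul_right hD hF ψ hw h' (star v * (x * star w))
  have h₃ := apply_mul_mem hD hF ψ (star_mul_self_mem hw) (star v * x)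
  rw [(isImplemented_src ψ hw h').star_mul_self] at h₃
  rw [show star v * x * (star w * w) = star v * (x * star w) * w by simp only [mul_assoc], h₂,
    ← hφψ, ← h₁] at h₃
  apply mul_right_cancel₀ h'
  linear_combination -h₃

/-- The normalizer vw implements this functional over s(ψ), with value φ(v)ψ(w). Composability is
used to evaluate r(ψ)(v*v) as |φ(v)|². -/
theorem translate_mem (hφψ : src φ = rng hD hF ψ) (hv : v ∈ normalizers D)
    (h : (φ : WeakDual ℂ C) v ≠ 0) :
    translate (conj ((φ : WeakDual ℂ C) v))⁻¹ (star v) (ψ : WeakDual ℂ C) ∈ eigF D F := by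
  obtain ⟨w, hw, h'⟩ := exists_apply_ne_zero hD ψ
  have hc : conj ((φ : WeakDual ℂ C) v) ≠ 0 := (map_ne_zero _).mpr h
  have h₁ : translate (conj ((φ : WeakDual ℂ C) v))⁻¹ (star v) (ψ : WeakDual ℂ C) (v * w) =
      (φ : WeakDual ℂ C) v * (ψ : WeakDual ℂ C) w := by
    rw [translate_apply, ← mul_assoc, apply_mem_mul hD hF ψ (star_mul_self_mem hv), ← hφψ,
      (isImplemented_src φ hv h).star_mul_self]
    field_simp
  refine IsImplemented.mem_eigF hD hF (src ψ).2 (mul_mem_normalizers hv hw)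
    ⟨by rw [h₁]; exact mul_ne_zero h h', fun x => ?_⟩
  rw [h₁, translate_apply, map_mul (starRingEnd ℂ), star_mul, mul_assoc (star w),
    ← (isImplemented_src ψ hw h').2]
  field_simp

/-- The product of a composable pair of eigenfunctionals. -/
noncomputable def eigMul (φ ψ : eigF D F) (hφψ : src φ = rng hD hF ψ) : eigF D F :=
  ⟨_, translate_mem hD hF hφψ (eigNormalizer_mem hD φ) (apply_eigNormalizer hD φ)⟩

/-- This frees the product from the chosen normalizer and characterises it without square roots. The
axioms and the continuity of the product rest on it. -/
theorem eigMul_apply (hφψ : src φ = rng hD hF ψ) (hv : v ∈ normalizers D)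
    (h : (φ : WeakDual ℂ C) v ≠ 0) (x : C) :
    (eigMul hD hF φ ψ hφψ : WeakDual ℂ C) x * conj ((φ : WeakDual ℂ C) v) =
      (ψ : WeakDual ℂ C) (star v * x) := by
  obtain ⟨w, hw, h'⟩ := exists_apply_ne_zero hD ψ
  have h₀ := apply_eigNormalizer hD φ
  have h₁ := apply_star_mul_comp hD hF hφψ hv h hw h' x
  have h₂ := apply_star_mul_comp hD hF hφψ (eigNormalizer_mem hD φ) h₀ hw h' x
  have hc : conj ((φ : WeakDual ℂ C) (eigNormalizer hD φ)) ≠ 0 := (map_ne_zero _).mpr h₀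
  have h₃ : (eigMul hD hF φ ψ hφψ : WeakDual ℂ C) x *
      conj ((φ : WeakDual ℂ C) (eigNormalizer hD φ)) =
        (ψ : WeakDual ℂ C) (star (eigNormalizer hD φ) * x) := by
    rw [eigMul, translate_apply, mul_right_comm, inv_mul_cancel₀ hc, one_mul]
  rw [← h₃] at h₂
  apply mul_right_cancel₀ (mul_ne_zero hc ((map_ne_zero (starRingEnd ℂ)).mpr h'))
  linear_combination conj ((φ : WeakDual ℂ C) v) * h₂ -
    conj ((φ : WeakDual ℂ C) (eigNormalizer hD φ)) * h₁

theorem eigMul_eq {χ : eigF D F} (hφψ : src φ = rng hD hF ψ) (hv : v ∈ normalizers D)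
    (h : (φ : WeakDual ℂ C) v ≠ 0)
    (hχ : ∀ x, (χ : WeakDual ℂ C) x * conj ((φ : WeakDual ℂ C) v) =
      (ψ : WeakDual ℂ C) (star v * x)) : eigMul hD hF φ ψ hφψ = χ :=
  eigF_ext fun x => mul_right_cancel₀ ((map_ne_zero (starRingEnd ℂ)).mpr h)
    ((eigMul_apply hD hF hφψ hv h x).trans (hχ x).symm)

theorem eigMul_apply_mul (hφψ : src φ = rng hD hF ψ) (hv : v ∈ normalizers D)
    (h : (φ : WeakDual ℂ C) v ≠ 0) (x : C) :
    (eigMul hD hF φ ψ hφψ : WeakDual ℂ C) (v * x) =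
      (φ : WeakDual ℂ C) v * (ψ : WeakDual ℂ C) x := by
  apply mul_right_cancel₀ ((map_ne_zero (starRingEnd ℂ)).mpr h)
  rw [eigMul_apply hD hF hφψ hv h, ← mul_assoc, apply_mem_mul hD hF ψ (star_mul_self_mem hv),
    ← hφψ, (isImplemented_src φ hv h).star_mul_self]
  ring

theorem src_eigMul (hφψ : src φ = rng hD hF ψ) : src (eigMul hD hF φ ψ hφψ) = src ψ := by
  obtain ⟨v, hv, h⟩ := exists_apply_ne_zero hD φ
  obtain ⟨w, hw, h'⟩ := exists_apply_ne_zero hD ψ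
  have h₁ := eigMul_apply_mul hD hF hφψ hv h
  refine src_eq (mul_mem_normalizers hv hw) (by rw [h₁]; exact mul_ne_zero h h') fun x => ?_
  rw [mul_assoc, h₁, h₁, apply_mul_left ψ hw h', mul_assoc]

theorem rng_eigMul (hφψ : src φ = rng hD hF ψ) :
    rng hD hF (eigMul hD hF φ ψ hφψ) = rng hD hF φ := by
  obtain ⟨v, hv, h⟩ := exists_apply_ne_zero hD φ
  obtain ⟨w, hw, h'⟩ := exists_apply_ne_zero hD ψ
  have h₁ := eigMul_apply_mul hD hF hφψ hv h
  refine rng_eq hD hF (mul_mem_normalizers hv hw) (by rw [h₁]; exact mul_ne_zero h h') fun x => ?_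
  apply mul_right_cancel₀ ((map_ne_zero (starRingEnd ℂ)).mpr h)
  rw [eigMul_apply hD hF hφψ hv h, h₁,
    show star v * (x * (v * w)) = star v * (x * v) * w by simp only [mul_assoc],
    apply_mul_right hD hF ψ hw h', ← hφψ, ← (isImplemented_src φ hv h).2,
    apply_mul_right hD hF φ hv h]
  ring

/-- The groupoid of `F`-compatible eigenfunctionals. -/
noncomputable def eigGroupoid : SetGroupoid (eigF D F) where
  Comp φ ψ := src φ = rng hD hF ψ
  mul φ ψ h := eigMul hD hF φ ψ h
  inv := eigInv hD hF
  inv_inv := eigInv_eigInv hD hF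
  assoc φ ψ θ h₁ h₂ := by
    refine ⟨(src_eigMul hD hF h₁).trans h₂, h₁.trans (rng_eigMul hD hF h₂).symm, ?_⟩
    -- The normalizer vw is admissible for φψ, whose value there is φ(v)ψ(w); dividing by its
    -- conjugate amounts to removing `v` and then `w`.
    obtain ⟨v, hv, h⟩ := exists_apply_ne_zero hD φ
    obtain ⟨w, hw, h'⟩ := exists_apply_ne_zero hD ψ
    have h₃ := eigMul_apply_mul hD hF h₁ hv h w
    refine eigMul_eq hD hF _ (mul_mem_normalizers hv hw) (by rw [h₃]; exact mul_ne_zero h h')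
      fun x => ?_
    rw [h₃, map_mul, ← mul_assoc, eigMul_apply hD hF _ hv h, eigMul_apply hD hF h₂ hw h',
      star_mul, mul_assoc]
  inv_comp _ := rfl
  comp_inv φ := (rng_eigInv hD hF φ).symm
  inv_mul_cancel φ ψ h₁ := by
    obtain ⟨v, hv, h⟩ := exists_apply_ne_zero hD φ
    refine ⟨(rng_eigMul hD hF h₁).symm, eigMul_eq hD hF _ (star_mem_normalizers hv)
      (by simpa using h) fun x => ?_⟩
    rw [star_star, eigMul_apply_mul hD hF h₁ hv h, eigInv_apply, star_star, Complex.conj_conj,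
      mul_comm]
  mul_inv_cancel φ ψ h₁ := by
    obtain ⟨v, hv, h⟩ := exists_apply_ne_zero hD φ
    obtain ⟨w, hw, h'⟩ := exists_apply_ne_zero hD ψ
    have h₂ := eigMul_apply_mul hD hF h₁ hv h w
    refine ⟨(src_eigMul hD hF h₁).trans (rng_eigInv hD hF ψ).symm, eigMul_eq hD hF _
      (mul_mem_normalizers hv hw) (by rw [h₂]; exact mul_ne_zero h h') fun x => ?_⟩
    rw [h₂, eigInv_apply, star_mul, star_star, ← mul_assoc,
      apply_mul_right hD hF ψ hw h', ← h₁,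
      show star x * v = star (star v * x) by rw [star_mul, star_star],
      map_star_of_state (state_compatible hF _).1, ← (isImplemented_src φ hv h).2]
    simp
    ring

theorem eigGroupoid_source (φ : eigF D F) :
    ((eigGroupoid hD hF).source φ : WeakDual ℂ C) = src φ := by
  obtain ⟨v, hv, h⟩ := exists_apply_ne_zero hD φ
  refine DFunLike.ext _ _ fun x => ?_
  apply mul_left_cancel₀ h
  have h₁ := eigMul_apply hD hF (φ := eigInv hD hF φ) (ψ := φ) rfl (star_mem_normalizers hv)
    (by simpa using h) x
  rw [star_star, apply_mul_left φ hv h, eigInv_apply, star_star, Complex.conj_conj] at h₁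
  rw [← h₁, mul_comm]; rfl

theorem eigGroupoid_range (φ : eigF D F) :
    ((eigGroupoid hD hF).range φ : WeakDual ℂ C) = rng hD hF φ := by
  have h := eigGroupoid_source hD hF (eigInv hD hF φ)
  rw [← rng] at h
  rw [← h, ← SetGroupoid.source_inv]; rfl

theorem isEigGroupoid : IsEigGroupoid D F (eigGroupoid hD hF) src (rng hD hF) where
  isSourceState := src_isSourceState
  isRangeState := rng_isRangeState hD hF
  comp_iff _ _ := Iff.rfl
  mul_apply φ ψ h₁ v hv w hw h h' x := by
    have h₂ := eigMul_apply_mul hD hF h₁ hv h.ne' w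
    have hi := isImplemented_src ψ hw h'.ne'
    have hi' : IsImplemented (eigMul hD hF φ ψ h₁ : WeakDual ℂ C) (src ψ) (v * w) := by
      rw [← src_eigMul hD hF h₁]
      exact isImplemented_src _ (mul_mem_normalizers hv hw)
        (by rw [h₂]; exact mul_ne_zero h.ne' h'.ne')
    exact hi'.apply_eq_bracket (by rw [h₂]; exact mul_pos h h') x
  inv_apply _ _ := rfl
  source_eq := eigGroupoid_source hD hF
  range_eq := eigGroupoid_range hD hF

end Operations

/-! ### The groupoid of moduli -/

/-- Equal moduli give equal kernels. As x − g(x)1 is killed by g, it is killed by f, and f(1) = 1.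
-/
theorem state_ext_of_norm_eq {f g : WeakDual ℂ C} (hf : f ∈ states C) (hg : g ∈ states C)
    (h : ∀ x, ‖f x‖ = ‖g x‖) : f = g := by
  refine DFunLike.ext _ _ fun x => ?_
  have h₁ := h (x - g x • 1)
  rw [map_sub, map_sub, map_smul, map_smul, hf.2, hg.2, smul_eq_mul, mul_one, sub_self, norm_zero,
    norm_eq_zero, sub_eq_zero] at h₁
  exact h₁

@[simp] theorem modulus_apply (φ : eigF D F) (x : C) :
    (modulus D F φ : C → ℝ) x = ‖(φ : WeakDual ℂ C) x‖ := rfl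

theorem modulus_eq_iff {φ ψ : eigF D F} : modulus D F φ = modulus D F ψ ↔
    ∀ x, ‖(φ : WeakDual ℂ C) x‖ = ‖(ψ : WeakDual ℂ C) x‖ :=
  Subtype.ext_iff.trans funext_iff

theorem modulus_surjective : Function.Surjective (modulus D F) := by
  rintro ⟨_, φ, hφ, rfl⟩
  exact ⟨⟨φ, hφ⟩, rfl⟩

/-- A complex number of modulus one, as an element of the circle. -/
def circleOf (c : ℂ) (hc : ‖c‖ = 1) : Circle := ⟨c, mem_sphere_zero_iff_norm.mpr hc⟩

@[simp] theorem circleOf_coe (c : ℂ) (hc : ‖c‖ = 1) : (circleOf c hc : ℂ) = c := rfl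

/-! ### The circle action, units, and descent to moduli -/

section Operations

variable (hD : IsRegularInclusion D) (hF : IsCompatibleCover D F)

theorem isImplemented_rotate (z : Circle) (φ : eigF D F) {v : C} (hv : v ∈ normalizers D)
    (h : (φ : WeakDual ℂ C) v ≠ 0) :
    IsImplemented (translate z 1 (φ : WeakDual ℂ C)) (src φ) v := by
  refine ⟨by simpa using h, fun x => ?_⟩
  have h₁ : (z : ℂ) * conj (z : ℂ) = 1 := by rw [Complex.mul_conj, Circle.normSq_coe]; simp
  rw [translate_apply, translate_apply, one_mul, one_mul, ← (isImplemented_src φ hv h).2, map_mul]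
  linear_combination (φ : WeakDual ℂ C) x * conj ((φ : WeakDual ℂ C) v) * h₁

/-- The multiple `z φ` of an eigenfunctional by a scalar of modulus one. -/
noncomputable def rotate (z : Circle) (φ : eigF D F) : eigF D F :=
  ⟨translate z 1 (φ : WeakDual ℂ C), by
    obtain ⟨v, hv, h⟩ := exists_apply_ne_zero hD φ
    exact (isImplemented_rotate z φ hv h).mem_eigF hD hF (src φ).2 hv⟩

@[simp] theorem rotate_apply (z : Circle) (φ : eigF D F) (x : C) :
    (rotate hD hF z φ : WeakDual ℂ C) x = z * (φ : WeakDual ℂ C) x := by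
  rw [rotate, translate_apply, one_mul]

@[simp] theorem src_rotate (z : Circle) (φ : eigF D F) : src (rotate hD hF z φ) = src φ := by
  obtain ⟨v, hv, h⟩ := exists_apply_ne_zero hD φ
  refine src_eq hv (by simpa using h) fun x => ?_
  rw [rotate_apply, rotate_apply, apply_mul_left φ hv h, mul_assoc]

@[simp] theorem rng_rotate (z : Circle) (φ : eigF D F) :
    rng hD hF (rotate hD hF z φ) = rng hD hF φ := by
  obtain ⟨v, hv, h⟩ := exists_apply_ne_zero hD φ
  refine rng_eq hD hF hv (by simpa using h) fun x => ?_
  rw [rotate_apply, rotate_apply, apply_mul_right hD hF φ hv h, mul_left_comm]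

@[simp] theorem modulus_rotate (z : Circle) (φ : eigF D F) :
    modulus D F (rotate hD hF z φ) = modulus D F φ :=
  modulus_eq_iff.mpr fun x => by rw [rotate_apply, norm_mul, Circle.norm_coe, one_mul]

/-- A state in the cover, as an eigenfunctional. -/
def unitEig (f : F) : eigF D F :=
  ⟨f, IsImplemented.mem_eigF hD hF f.2 one_mem_normalizers
    ⟨by simp [(state_compatible hF f).1.2], fun x => by simp [(state_compatible hF f).1.2]⟩⟩

@[simp] theorem unitEig_coe (f : F) : (unitEig hD hF f : WeakDual ℂ C) = f := rfl

theorem unitEig_one (f : F) : (unitEig hD hF f : WeakDual ℂ C) 1 = 1 :=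
  (state_compatible hF f).1.2

@[simp] theorem src_unitEig (f : F) : src (unitEig hD hF f) = f :=
  src_eq one_mem_normalizers (by simp [unitEig_one, -unitEig_coe])
    fun x => by rw [unitEig_one, one_mul, one_mul, unitEig_coe]

@[simp] theorem rng_unitEig (f : F) : rng hD hF (unitEig hD hF f) = f :=
  rng_eq hD hF one_mem_normalizers (by simp [unitEig_one, -unitEig_coe])
    fun x => by rw [unitEig_one, mul_one, mul_one, unitEig_coe]

theorem eigGroupoid_source_eq (φ : eigF D F) :
    (eigGroupoid hD hF).source φ = unitEig hD hF (src φ) :=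
  Subtype.ext (eigGroupoid_source hD hF φ)

theorem eigGroupoid_units : (eigGroupoid hD hF).units = Set.range (unitEig hD hF) := by
  ext φ
  constructor
  · intro h
    exact ⟨src φ, ((eigGroupoid_source_eq hD hF φ).symm.trans h.symm)⟩
  · rintro ⟨f, rfl⟩
    change _ = _
    rw [eigGroupoid_source_eq, src_unitEig]

variable {φ ψ φ' ψ' : eigF D F}

/-- Both functionals are multiples of f(v*·) for the common source f, and |φ(v)|² = f(v*v) =
|ψ(v)|². The scalar is therefore φ(v)/ψ(v), of modulus one. -/
theorem exists_rotate_eq {v : C} (hv : v ∈ normalizers D) (h : (φ : WeakDual ℂ C) v ≠ 0)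
    (h' : (ψ : WeakDual ℂ C) v ≠ 0) (hs : src φ = src ψ) : ∃ z, φ = rotate hD hF z ψ := by
  have hi := isImplemented_src φ hv h
  have hi' := isImplemented_src ψ hv h'
  have h₁ : ‖(φ : WeakDual ℂ C) v‖ = ‖(ψ : WeakDual ℂ C) v‖ := by
    have h₂ := hi.star_mul_self
    rw [hs, hi'.star_mul_self, ← ofReal_norm_sq, ← ofReal_norm_sq] at h₂
    exact ((sq_eq_sq₀ (norm_nonneg _) (norm_nonneg _)).mp (Complex.ofReal_injective h₂)).symm
  refine ⟨circleOf ((φ : WeakDual ℂ C) v / (ψ : WeakDual ℂ C) v)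
    (by rw [norm_div, h₁, div_self (norm_ne_zero_iff.mpr h')]), eigF_ext fun x => ?_⟩
  rw [rotate_apply, circleOf_coe]
  rw [div_mul_eq_mul_div, eq_div_iff h']
  apply mul_right_cancel₀ hi.conj_ne_zero
  have h₂ := hi.2 x
  have h₃ := hi.2 v
  rw [hs, ← hi'.2] at h₂ h₃
  linear_combination (ψ : WeakDual ℂ C) v * h₂ - (ψ : WeakDual ℂ C) x * h₃

/-- From |φ(vx)| = |φ(v)||s(φ)(x)| the modulus of φ determines that of its source state, hence the
state. -/
theorem src_eq_of_modulus_eq (hD : IsRegularInclusion D) (hF : IsCompatibleCover D F)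
    (h : modulus D F φ = modulus D F ψ) : src φ = src ψ := by
  rw [modulus_eq_iff] at h
  obtain ⟨v, hv, h₀⟩ := exists_apply_ne_zero hD φ
  have h₁ : (ψ : WeakDual ℂ C) v ≠ 0 := by rwa [← norm_ne_zero_iff, ← h, norm_ne_zero_iff]
  refine Subtype.ext (state_ext_of_norm_eq (state_compatible hF _).1 (state_compatible hF _).1
    fun x => ?_)
  have h₂ := h (v * x)
  rw [apply_mul_left φ hv h₀, apply_mul_left ψ hv h₁, norm_mul, norm_mul, h] at h₂
  exact mul_left_cancel₀ (norm_ne_zero_iff.mpr h₁) h₂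

theorem modulus_eq_iff_exists_rotate :
    modulus D F φ = modulus D F ψ ↔ ∃ z, φ = rotate hD hF z ψ := by
  constructor
  · intro h
    obtain ⟨v, hv, h₀⟩ := exists_apply_ne_zero hD φ
    have h₁ : (ψ : WeakDual ℂ C) v ≠ 0 := by
      rwa [← norm_ne_zero_iff, ← modulus_eq_iff.mp h, norm_ne_zero_iff]
    exact exists_rotate_eq hD hF hv h₀ h₁ (src_eq_of_modulus_eq hD hF h)
  · rintro ⟨z, rfl⟩
    exact modulus_rotate hD hF z ψ

theorem modulus_eigInv (h : modulus D F φ = modulus D F ψ) :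
    modulus D F (eigInv hD hF φ) = modulus D F (eigInv hD hF ψ) := by
  rw [modulus_eq_iff] at h ⊢
  simpa using fun x => h (star x)

theorem rng_eq_of_modulus_eq (h : modulus D F φ = modulus D F ψ) :
    rng hD hF φ = rng hD hF ψ :=
  src_eq_of_modulus_eq hD hF (modulus_eigInv hD hF h)

/-- Only moduli occur on the right, so the product descends; the same formula later gives
continuity. -/
theorem modulus_eigMul_apply (h₁ : src φ = rng hD hF ψ) {v : C} (hv : v ∈ normalizers D)
    (h : (φ : WeakDual ℂ C) v ≠ 0) (x : C) :
    (modulus D F (eigMul hD hF φ ψ h₁) : C → ℝ) x =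
      (modulus D F ψ : C → ℝ) (star v * x) / (modulus D F φ : C → ℝ) v := by
  rw [modulus_apply, modulus_apply, modulus_apply, eq_div_iff (norm_ne_zero_iff.mpr h),
    ← eigMul_apply hD hF h₁ hv h, norm_mul, RCLike.norm_conj]

theorem modulus_eigMul (h : modulus D F φ = modulus D F φ') (h' : modulus D F ψ = modulus D F ψ')
    (h₁ : src φ = rng hD hF ψ) (h₂ : src φ' = rng hD hF ψ') :
    modulus D F (eigMul hD hF φ ψ h₁) = modulus D F (eigMul hD hF φ' ψ' h₂) := by
  obtain ⟨v, hv, h₀⟩ := exists_apply_ne_zero hD φ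
  have h₃ : (φ' : WeakDual ℂ C) v ≠ 0 := by
    rwa [← norm_ne_zero_iff, ← modulus_eq_iff.mp h, norm_ne_zero_iff]
  refine Subtype.ext (funext fun x => ?_)
  rw [modulus_eigMul_apply hD hF h₁ hv h₀, modulus_eigMul_apply hD hF h₂ hv h₃, h, h']

/-- An eigenfunctional with a given modulus. -/
noncomputable def lift (α : specF D F) : eigF D F := (modulus_surjective α).choose

@[simp] theorem modulus_lift (α : specF D F) : modulus D F (lift α) = α :=
  (modulus_surjective α).choose_spec

/-- The source state of a modulus. -/
noncomputable def specSrc (α : specF D F) : F := src (lift α)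

/-- The range state of a modulus. -/
noncomputable def specRng (α : specF D F) : F := rng hD hF (lift α)

theorem specSrc_modulus (hD : IsRegularInclusion D) (hF : IsCompatibleCover D F) (φ : eigF D F) :
    specSrc (modulus D F φ) = src φ :=
  src_eq_of_modulus_eq hD hF (modulus_lift _)

theorem specRng_modulus (φ : eigF D F) : specRng hD hF (modulus D F φ) = rng hD hF φ :=
  rng_eq_of_modulus_eq hD hF (modulus_lift _)

/-- The product of moduli. -/
noncomputable def specMul (α β : specF D F) (h : specSrc α = specRng hD hF β) : specF D F :=
  modulus D F (eigMul hD hF (lift α) (lift β) h)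

/-- The inverse of a modulus. -/
noncomputable def specInv (α : specF D F) : specF D F := modulus D F (eigInv hD hF (lift α))

theorem comp_modulus_iff : specSrc (modulus D F φ) = specRng hD hF (modulus D F ψ) ↔
    src φ = rng hD hF ψ := by
  rw [specSrc_modulus hD hF, specRng_modulus]

theorem specMul_modulus (h : specSrc (modulus D F φ) = specRng hD hF (modulus D F ψ)) :
    specMul hD hF _ _ h = modulus D F (eigMul hD hF φ ψ ((comp_modulus_iff hD hF).mp h)) :=
  modulus_eigMul hD hF (modulus_lift _) (modulus_lift _) _ _

theorem specInv_modulus (φ : eigF D F) :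
    specInv hD hF (modulus D F φ) = modulus D F (eigInv hD hF φ) :=
  modulus_eigInv hD hF (modulus_lift _)

theorem specMul_congr {α α' β β' : specF D F} (hα : α = α') (hβ : β = β')
    (h : specSrc α' = specRng hD hF β') : ∃ h' : specSrc α = specRng hD hF β,
      specMul hD hF α β h' = specMul hD hF α' β' h := by
  subst hα; subst hβ; exact ⟨h, rfl⟩

/-- The groupoid of moduli of `F`-compatible eigenfunctionals. -/
noncomputable def specGroupoid : SetGroupoid (specF D F) where
  Comp α β := specSrc α = specRng hD hF β
  mul α β h := specMul hD hF α β h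
  inv := specInv hD hF
  inv_inv α := by
    obtain ⟨φ, rfl⟩ := modulus_surjective α
    rw [specInv_modulus, specInv_modulus, eigInv_eigInv]
  assoc α β γ h₁ h₂ := by
    obtain ⟨φ, rfl⟩ := modulus_surjective α
    obtain ⟨ψ, rfl⟩ := modulus_surjective β
    obtain ⟨θ, rfl⟩ := modulus_surjective γ
    have h₁' := (comp_modulus_iff hD hF).mp h₁
    have h₂' := (comp_modulus_iff hD hF).mp h₂
    obtain ⟨h₃, h₄, e⟩ := (eigGroupoid hD hF).assoc φ ψ θ h₁' h₂'
    obtain ⟨h₅, e₁⟩ := specMul_congr hD hF (specMul_modulus hD hF h₁) rfl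
      ((comp_modulus_iff hD hF).mpr h₃)
    obtain ⟨h₆, e₂⟩ := specMul_congr hD hF rfl (specMul_modulus hD hF h₂)
      ((comp_modulus_iff hD hF).mpr h₄)
    refine ⟨h₅, h₆, ?_⟩
    rw [e₁, e₂, specMul_modulus, specMul_modulus]
    exact congrArg _ e
  inv_comp α := by
    obtain ⟨φ, rfl⟩ := modulus_surjective α
    rw [specInv_modulus, comp_modulus_iff]
    exact (eigGroupoid hD hF).inv_comp φ
  comp_inv α := by
    obtain ⟨φ, rfl⟩ := modulus_surjective α
    rw [specInv_modulus, comp_modulus_iff]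
    exact (eigGroupoid hD hF).comp_inv φ
  inv_mul_cancel α β h := by
    obtain ⟨φ, rfl⟩ := modulus_surjective α
    obtain ⟨ψ, rfl⟩ := modulus_surjective β
    obtain ⟨h₁, e⟩ := (eigGroupoid hD hF).inv_mul_cancel φ ψ ((comp_modulus_iff hD hF).mp h)
    obtain ⟨h₂, e₁⟩ := specMul_congr hD hF (specInv_modulus hD hF φ) (specMul_modulus hD hF h)
      ((comp_modulus_iff hD hF).mpr h₁)
    refine ⟨h₂, ?_⟩
    rw [e₁, specMul_modulus]
    exact congrArg _ e
  mul_inv_cancel α β h := by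
    obtain ⟨φ, rfl⟩ := modulus_surjective α
    obtain ⟨ψ, rfl⟩ := modulus_surjective β
    obtain ⟨h₁, e⟩ := (eigGroupoid hD hF).mul_inv_cancel φ ψ ((comp_modulus_iff hD hF).mp h)
    obtain ⟨h₂, e₁⟩ := specMul_congr hD hF (specMul_modulus hD hF h) (specInv_modulus hD hF ψ)
      ((comp_modulus_iff hD hF).mpr h₁)
    refine ⟨h₂, ?_⟩
    rw [e₁, specMul_modulus]
    exact congrArg _ e

theorem isSpecGroupoid : IsSpecGroupoid D F (eigGroupoid hD hF) (specGroupoid hD hF) where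
  comp_iff α β := by
    constructor
    · exact fun h => ⟨lift α, lift β, modulus_lift α, modulus_lift β, h⟩
    · rintro ⟨φ, ψ, rfl, rfl, h⟩
      exact (comp_modulus_iff hD hF).mpr h
  mul_eq _ _ _ h' := specMul_modulus hD hF h'
  inv_eq := specInv_modulus hD hF

theorem isHom_modulus : (eigGroupoid hD hF).IsHom (specGroupoid hD hF) (modulus D F) :=
  fun _ _ h => ⟨(comp_modulus_iff hD hF).mpr h, (specMul_modulus hD hF _).symm⟩

theorem specGroupoid_source (φ : eigF D F) :
    (specGroupoid hD hF).source (modulus D F φ) = modulus D F (unitEig hD hF (src φ)) := by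
  obtain ⟨_, e⟩ := (specGroupoid hD hF).mul_congr (specInv_modulus hD hF φ) rfl
    ((specGroupoid hD hF).inv_comp _)
  refine e.trans ((specMul_modulus hD hF _).trans ?_)
  rw [← eigGroupoid_source_eq]; rfl

theorem specGroupoid_range (φ : eigF D F) :
    (specGroupoid hD hF).range (modulus D F φ) = modulus D F (unitEig hD hF (rng hD hF φ)) := by
  rw [← SetGroupoid.source_inv]
  refine (congrArg _ (specInv_modulus hD hF φ)).trans (specGroupoid_source hD hF _)

theorem specGroupoid_units :
    (specGroupoid hD hF).units = Set.range fun f => modulus D F (unitEig hD hF f) := by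
  ext α
  constructor
  · intro h
    obtain ⟨φ, rfl⟩ := modulus_surjective α
    exact ⟨src φ, (specGroupoid_source hD hF φ).symm.trans h.symm⟩
  · rintro ⟨f, rfl⟩
    change _ = _
    rw [specGroupoid_source, src_unitEig]

end Operations

/-! ### Topology -/

theorem continuous_eigF_apply (x : C) : Continuous fun φ : eigF D F => (φ : WeakDual ℂ C) x :=
  (WeakDual.eval_continuous x).comp continuous_subtype_val

theorem continuous_state_apply (x : C) : Continuous fun f : F => (f : WeakDual ℂ C) x :=
  (WeakDual.eval_continuous x).comp continuous_subtype_val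

theorem continuous_specF_apply (x : C) : Continuous fun α : specF D F => (α : C → ℝ) x :=
  (continuous_apply x).comp continuous_subtype_val

theorem continuous_of_apply {X : Type*} [TopologicalSpace X] {S : Set (WeakDual ℂ C)} {g : X → S}
    (h : ∀ x, Continuous fun a => (g a : WeakDual ℂ C) x) : Continuous g :=
  continuous_induced_rng.mpr (WeakDual.continuous_of_continuous_eval h)

theorem continuous_specF_of_apply {X : Type*} [TopologicalSpace X] {g : X → specF D F}
    (h : ∀ x, Continuous fun a => (g a : C → ℝ) x) : Continuous g :=
  continuous_induced_rng.mpr (continuous_pi h)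

theorem continuous_modulus : Continuous (modulus D F) :=
  continuous_specF_of_apply fun x => (continuous_eigF_apply x).norm

theorem weakDual_t2 : T2Space (WeakDual ℂ C) :=
  T2Space.of_injective_continuous DFunLike.coe_injective WeakDual.coeFn_continuous

theorem SetGroupoid.IsTopological.continuous_source {X : Type*} [TopologicalSpace X]
    {G : SetGroupoid X} (hG : G.IsTopological) : Continuous G.source :=
  hG.continuous_mul.comp
    (Continuous.subtype_mk (hG.continuous_inv.prodMk continuous_id) G.inv_comp)

theorem locallyCompactSpace_of_open_cover {X : Type*} [TopologicalSpace X] [T2Space X]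
    (h : ∀ x : X, ∃ U : Set X, IsOpen U ∧ x ∈ U ∧ LocallyCompactSpace U) :
    LocallyCompactSpace X := by
  have : WeaklyLocallyCompactSpace X := ⟨fun x => by
    obtain ⟨U, hU, hx, _⟩ := h x
    obtain ⟨K, hK, hKx⟩ := exists_compact_mem_nhds (⟨x, hx⟩ : U)
    exact ⟨Subtype.val '' K, hK.image continuous_subtype_val,
      hU.isOpenMap_subtype_val.image_mem_nhds hKx⟩⟩
  infer_instance

/-! ### Continuity of the operations, compactness of the cover, and the sections [v, f] -/

section Operations

variable (hD : IsRegularInclusion D) (hF : IsCompatibleCover D F)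

theorem compactSpace_cover (hF : IsCompatibleCover D F) : CompactSpace F := by
  refine isCompact_iff_compactSpace.mp
    ((WeakDual.isCompact_closedBall (𝕜 := ℂ) 0 1).of_isClosed_subset hF.isClosed fun f hf => ?_)
  rw [Set.mem_preimage, mem_closedBall_zero_iff]
  exact ContinuousLinearMap.opNorm_le_bound _ zero_le_one
    (fun x => by rw [one_mul]; exact norm_le_of_state (hF.subset hf).1 x)

/-- A normalizer admissible for φ stays admissible nearby. With it fixed, each value of the product
is a quotient of evaluations. -/
theorem eigGroupoid_isTopological : (eigGroupoid hD hF).IsTopological where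
  continuous_mul := by
    refine continuous_of_apply fun x => continuous_iff_continuousAt.mpr fun p => ?_
    obtain ⟨v, hv, h⟩ := exists_apply_ne_zero hD p.1.1
    have hc : Continuous fun q : {p : eigF D F × eigF D F // (eigGroupoid hD hF).Comp p.1 p.2} =>
        (q.1.1 : WeakDual ℂ C) v := (continuous_eigF_apply v).comp (by fun_prop)
    have hc' : Continuous fun q : {p : eigF D F × eigF D F // (eigGroupoid hD hF).Comp p.1 p.2} =>
        (q.1.2 : WeakDual ℂ C) (star v * x) := (continuous_eigF_apply _).comp (by fun_prop)
    refine (hc'.continuousAt.div (Complex.continuous_conj.comp hc).continuousAt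
      ((map_ne_zero _).mpr h)).congr ?_
    filter_upwards [hc.continuousAt.eventually_ne h] with q hq
    exact ((eq_div_iff ((map_ne_zero (starRingEnd ℂ)).mpr hq)).mpr
      (eigMul_apply hD hF q.2 hv hq x)).symm
  continuous_inv := continuous_of_apply fun x =>
    Complex.continuous_conj.comp (continuous_eigF_apply (star x))

theorem exists_spec_apply_ne_zero (hD : IsRegularInclusion D) (α : specF D F) :
    ∃ v ∈ normalizers D, (α : C → ℝ) v ≠ 0 := by
  obtain ⟨φ, rfl⟩ := modulus_surjective α
  obtain ⟨v, hv, h⟩ := exists_apply_ne_zero hD φ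
  exact ⟨v, hv, norm_ne_zero_iff.mpr h⟩

theorem lift_apply_ne_zero {α : specF D F} {v : C} (h : (α : C → ℝ) v ≠ 0) :
    (lift α : WeakDual ℂ C) v ≠ 0 := by
  rwa [← norm_ne_zero_iff, ← modulus_apply, modulus_lift]

theorem specMul_apply {α β : specF D F} (h : specSrc α = specRng hD hF β) {v : C}
    (hv : v ∈ normalizers D) (h₀ : (α : C → ℝ) v ≠ 0) (x : C) :
    (specMul hD hF α β h : C → ℝ) x = (β : C → ℝ) (star v * x) / (α : C → ℝ) v := by
  rw [specMul, modulus_eigMul_apply hD hF h hv (lift_apply_ne_zero h₀), modulus_lift, modulus_lift]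

theorem specInv_apply (α : specF D F) (x : C) :
    (specInv hD hF α : C → ℝ) x = (α : C → ℝ) (star x) := by
  rw [specInv, modulus_apply, eigInv_apply, RCLike.norm_conj, ← modulus_apply, modulus_lift]

theorem specGroupoid_isTopological : (specGroupoid hD hF).IsTopological where
  continuous_mul := by
    refine continuous_specF_of_apply fun x => continuous_iff_continuousAt.mpr fun p => ?_
    obtain ⟨v, hv, h⟩ := exists_spec_apply_ne_zero hD p.1.1
    have hc : Continuous fun q : {p : specF D F × specF D F // (specGroupoid hD hF).Comp p.1 p.2} =>
        (q.1.1 : C → ℝ) v := (continuous_specF_apply v).comp (by fun_prop)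
    have hc' : Continuous fun q : {p : specF D F × specF D F //
        (specGroupoid hD hF).Comp p.1 p.2} =>
        (q.1.2 : C → ℝ) (star v * x) := (continuous_specF_apply _).comp (by fun_prop)
    refine (hc'.continuousAt.div hc.continuousAt h).congr ?_
    filter_upwards [hc.continuousAt.eventually_ne h] with q hq
    exact (specMul_apply hD hF q.2 hv hq x).symm
  continuous_inv := continuous_specF_of_apply fun x => by
    simp only [specGroupoid, specInv_apply]
    exact continuous_specF_apply (star x)

/-- The identification of the cover with the unit space of the groupoid of moduli. -/
noncomputable def unitHomeo : F ≃ₜ (specGroupoid hD hF).units :=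
  have : CompactSpace F := compactSpace_cover hF
  Continuous.homeoOfEquivCompactToT2
    (f := Equiv.ofBijective
      (fun f : F => (⟨modulus D F (unitEig hD hF f), by
        rw [specGroupoid_units]; exact ⟨f, rfl⟩⟩ : (specGroupoid hD hF).units))
      ⟨fun f g h => by
        have := src_eq_of_modulus_eq hD hF (congrArg Subtype.val h)
        simpa using this,
      fun u => by
        obtain ⟨f, hf⟩ := (specGroupoid_units hD hF).subset u.2
        exact ⟨f, Subtype.ext hf⟩⟩)
    (continuous_induced_rng.mpr (continuous_modulus.comp
      (continuous_of_apply fun x => continuous_state_apply x)))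

theorem unitHomeo_coe (f : F) :
    (unitHomeo hD hF f : specF D F) = modulus D F (unitEig hD hF f) := rfl

theorem sourceMap_eq (α : specF D F) :
    (specGroupoid hD hF).sourceMap α = unitHomeo hD hF (specSrc α) := by
  obtain ⟨φ, rfl⟩ := modulus_surjective α
  refine Subtype.ext ?_
  rw [unitHomeo_coe, specSrc_modulus hD hF]
  exact specGroupoid_source hD hF φ

theorem rangeMap_eq (α : specF D F) :
    (specGroupoid hD hF).rangeMap α = unitHomeo hD hF (specRng hD hF α) := by
  obtain ⟨φ, rfl⟩ := modulus_surjective α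
  refine Subtype.ext ?_
  rw [unitHomeo_coe, specRng_modulus hD hF]
  exact specGroupoid_range hD hF φ

/-- Continuity is inherited from α ↦ α⁻¹α through the homeomorphism of F with the unit space. -/
theorem continuous_specSrc (hD : IsRegularInclusion D) (hF : IsCompatibleCover D F) :
    Continuous (specSrc : specF D F → F) := by
  have h : Continuous (specGroupoid hD hF).sourceMap :=
    continuous_induced_rng.mpr (specGroupoid_isTopological hD hF).continuous_source
  have h₁ : (specSrc : specF D F → F) =
      (unitHomeo hD hF).symm ∘ (specGroupoid hD hF).sourceMap := by
    funext α
    rw [Function.comp_apply, sourceMap_eq, Homeomorph.symm_apply_apply]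
  rw [h₁]
  exact (unitHomeo hD hF).symm.continuous.comp h

/-- The moduli that do not vanish at `v`. -/
def specSupport (D : StarSubalgebra ℂ C) (F : Set (WeakDual ℂ C)) (v : C) : Set (specF D F) :=
  {α | (α : C → ℝ) v ≠ 0}

/-- The states in the cover that do not vanish at `v* v`. -/
def coverSupport (F : Set (WeakDual ℂ C)) (v : C) : Set F :=
  {f | (f : WeakDual ℂ C) (star v * v) ≠ 0}

theorem isOpen_specSupport (v : C) : IsOpen (specSupport D F v) :=
  isOpen_ne.preimage (continuous_specF_apply v)

theorem isOpen_coverSupport (v : C) : IsOpen (coverSupport F v) :=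
  isOpen_ne.preimage (continuous_state_apply _)

theorem specSrc_mem_coverSupport {v : C} (hv : v ∈ normalizers D) {α : specF D F}
    (h : α ∈ specSupport D F v) : specSrc α ∈ coverSupport F v :=
  (isImplemented_src (lift α) hv (lift_apply_ne_zero h)).star_mul_self_ne_zero

/-- The factor `f(v* v)^{-1/2}`. -/
noncomputable def bracketFactor (v : C) (f : WeakDual ℂ C) : ℂ :=
  ((√(f (star v * v)).re : ℝ) : ℂ)⁻¹

theorem bracketFactor_ne_zero {f : WeakDual ℂ C} (hf : f ∈ states C) {v : C}
    (h : f (star v * v) ≠ 0) : ((√(f (star v * v)).re : ℝ) : ℂ) ≠ 0 := by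
  have h₁ : 0 ≤ (f (star v * v)).re := (Complex.nonneg_iff.mp (hf.1 v)).1
  have h₂ : (f (star v * v)).re ≠ 0 := fun h₂ => h (by
    rw [state_star_mul_self hf v, h₂, Complex.ofReal_zero])
  rw [Complex.ofReal_ne_zero]
  exact (Real.sqrt_pos.mpr (lt_of_le_of_ne h₁ h₂.symm)).ne'

theorem isImplemented_bracket {f : WeakDual ℂ C} (hf : f ∈ states C) {v : C}
    (h : f (star v * v) ≠ 0) : IsImplemented (translate (bracketFactor v f) (star v) f) f v := by
  have h₁ := bracketFactor_ne_zero hf h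
  have h₂ : f (star v * v) =
      ((√(f (star v * v)).re : ℝ) : ℂ) * ((√(f (star v * v)).re : ℝ) : ℂ) := by
    rw [← Complex.ofReal_mul, Real.mul_self_sqrt (Complex.nonneg_iff.mp (hf.1 v)).1,
      ← state_star_mul_self hf]
  have h₃ : translate (bracketFactor v f) (star v) f v = ((√(f (star v * v)).re : ℝ) : ℂ) := by
    rw [translate_apply, bracketFactor, inv_mul_eq_iff_eq_mul₀ h₁, ← h₂]
  refine ⟨by rwa [h₃], fun x => ?_⟩
  rw [h₃, Complex.conj_ofReal, translate_apply, bracketFactor, mul_right_comm,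
    inv_mul_cancel₀ h₁, one_mul]

/-- The eigenfunctional `[v, f]`. -/
noncomputable def bracketEig {v : C} (hv : v ∈ normalizers D) (f : coverSupport F v) : eigF D F :=
  ⟨translate (bracketFactor v (f : WeakDual ℂ C)) (star v) (f : WeakDual ℂ C),
    (isImplemented_bracket (state_compatible hF f.1).1 f.2).mem_eigF hD hF f.1.2 hv⟩

variable {v : C} (hv : v ∈ normalizers D)

theorem bracketEig_apply_ne_zero (f : coverSupport F v) :
    (bracketEig hD hF hv f : WeakDual ℂ C) v ≠ 0 :=
  (isImplemented_bracket (state_compatible hF f.1).1 f.2).1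

theorem src_bracketEig (f : coverSupport F v) : src (bracketEig hD hF hv f) = f :=
  src_eq hv (bracketEig_apply_ne_zero hD hF hv f)
    ((isImplemented_bracket (state_compatible hF f.1).1 f.2).mul_left (state_compatible hF f.1) hv)

theorem continuous_bracketEig : Continuous (bracketEig hD hF hv) := by
  refine continuous_of_apply fun x => ?_
  have hc : ∀ y, Continuous fun f : coverSupport F v => (f.1 : WeakDual ℂ C) y :=
    fun y => (continuous_state_apply y).comp continuous_subtype_val
  refine Continuous.mul (Continuous.inv₀ ?_ fun f => ?_) (hc _)
  · exact Complex.continuous_ofReal.comp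
      (Real.continuous_sqrt.comp (Complex.continuous_re.comp (hc _)))
  · exact bracketFactor_ne_zero (state_compatible hF f.1).1 f.2

end Operations

/-! ### Local sections, bisections and étaleness -/

section Operations

variable (hD : IsRegularInclusion D) (hF : IsCompatibleCover D F) {v : C} (hv : v ∈ normalizers D)

/-- The continuous section `|φ| ↦ [v, s(φ)]` of `φ ↦ |φ|`. -/
noncomputable def specSection (α : specSupport D F v) : eigF D F :=
  bracketEig hD hF hv ⟨specSrc α.1, specSrc_mem_coverSupport hv α.2⟩

theorem continuous_specSection : Continuous (specSection hD hF hv) :=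
  (continuous_bracketEig hD hF hv).comp
    (((continuous_specSrc hD hF).comp continuous_subtype_val).subtype_mk _)

theorem specSection_apply_ne_zero (α : specSupport D F v) :
    (specSection hD hF hv α : WeakDual ℂ C) v ≠ 0 := bracketEig_apply_ne_zero hD hF hv _

theorem src_specSection (α : specSupport D F v) : src (specSection hD hF hv α) = specSrc α.1 :=
  src_bracketEig hD hF hv _

theorem modulus_eq_of_src_eq (hD : IsRegularInclusion D) (hF : IsCompatibleCover D F)
    (hv : v ∈ normalizers D) {φ ψ : eigF D F} (h : (φ : WeakDual ℂ C) v ≠ 0)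
    (h' : (ψ : WeakDual ℂ C) v ≠ 0) (hs : src φ = src ψ) : modulus D F φ = modulus D F ψ :=
  (modulus_eq_iff_exists_rotate hD hF).mpr (exists_rotate_eq hD hF hv h h' hs)

theorem modulus_specSection (α : specSupport D F v) :
    modulus D F (specSection hD hF hv α) = α := by
  rw [← modulus_lift α.1]
  exact modulus_eq_of_src_eq hD hF hv (specSection_apply_ne_zero hD hF hv α)
    (lift_apply_ne_zero α.2) (src_specSection hD hF hv α)

/-- The source map is a homeomorphism from the moduli that do not vanish at `v` onto the states
that do not vanish at `v* v`. -/
noncomputable def supportHomeo : specSupport D F v ≃ₜ coverSupport F v where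
  toFun α := ⟨specSrc α.1, specSrc_mem_coverSupport hv α.2⟩
  invFun f := ⟨modulus D F (bracketEig hD hF hv f),
    norm_ne_zero_iff.mpr (bracketEig_apply_ne_zero hD hF hv f)⟩
  left_inv α := Subtype.ext (modulus_specSection hD hF hv α)
  right_inv f := Subtype.ext ((specSrc_modulus hD hF _).trans (src_bracketEig hD hF hv f))
  continuous_toFun := ((continuous_specSrc hD hF).comp continuous_subtype_val).subtype_mk _
  continuous_invFun := (continuous_modulus.comp (continuous_bracketEig hD hF hv)).subtype_mk _

theorem isOpenEmbedding_specSrc (hD : IsRegularInclusion D) (hF : IsCompatibleCover D F)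
    (hv : v ∈ normalizers D) :
    Topology.IsOpenEmbedding ((specSupport D F v).domRestrict specSrc) :=
  (isOpen_coverSupport v).isOpenEmbedding_subtypeVal.comp
    (supportHomeo hD hF hv).isOpenEmbedding

theorem isLocalHomeomorph_specSrc (hD : IsRegularInclusion D) (hF : IsCompatibleCover D F) :
    IsLocalHomeomorph (specSrc : specF D F → F) := by
  rw [isLocalHomeomorph_iff_isOpenEmbedding_restrict]
  intro α
  obtain ⟨v, hv, h⟩ := exists_spec_apply_ne_zero hD α
  exact ⟨specSupport D F v, (isOpen_specSupport v).mem_nhds h, isOpenEmbedding_specSrc hD hF hv⟩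

/-- The inversion, as a homeomorphism. -/
noncomputable def specInvHomeo : specF D F ≃ₜ specF D F where
  toFun := (specGroupoid hD hF).inv
  invFun := (specGroupoid hD hF).inv
  left_inv := (specGroupoid hD hF).inv_inv
  right_inv := (specGroupoid hD hF).inv_inv
  continuous_toFun := (specGroupoid_isTopological hD hF).continuous_inv
  continuous_invFun := (specGroupoid_isTopological hD hF).continuous_inv

theorem specRng_eq (α : specF D F) : specRng hD hF α = specSrc (specInv hD hF α) :=
  (specSrc_modulus hD hF _).symm

theorem isLocalHomeomorph_sourceMap : IsLocalHomeomorph (specGroupoid hD hF).sourceMap := by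
  have h : (specGroupoid hD hF).sourceMap = unitHomeo hD hF ∘ specSrc :=
    funext (sourceMap_eq hD hF)
  rw [h]
  exact (unitHomeo hD hF).isLocalHomeomorph.comp (isLocalHomeomorph_specSrc hD hF)

theorem isLocalHomeomorph_rangeMap : IsLocalHomeomorph (specGroupoid hD hF).rangeMap := by
  have h : (specGroupoid hD hF).rangeMap = unitHomeo hD hF ∘ specSrc ∘ specInvHomeo hD hF :=
    funext fun α => (rangeMap_eq hD hF α).trans (congrArg _ (specRng_eq hD hF α))
  rw [h]
  exact (unitHomeo hD hF).isLocalHomeomorph.comp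
    ((isLocalHomeomorph_specSrc hD hF).comp (specInvHomeo hD hF).isLocalHomeomorph)

theorem injOn_specSrc (hD : IsRegularInclusion D) (hF : IsCompatibleCover D F)
    (hv : v ∈ normalizers D) :
    Set.InjOn (specSrc : specF D F → F) (specSupport D F v) :=
  Set.injOn_iff_injective.mpr (isOpenEmbedding_specSrc hD hF hv).injective

theorem isOpenEmbedding_domRestrict {X Y : Type*} [TopologicalSpace X] [TopologicalSpace Y]
    {f : X → Y} (hf : IsLocalHomeomorph f) {U : Set X} (hU : IsOpen U) (h : Set.InjOn f U) :
    Topology.IsOpenEmbedding (U.domRestrict f) :=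
  (hf.comp hU.isOpenEmbedding_subtypeVal.isLocalHomeomorph).isOpenEmbedding_of_injective
    (Set.injOn_iff_injective.mp h)

/-- Injectivity of the source on the support of `v` transfers to the range, since inversion carries
the support of `v` to that of `v*`. -/
theorem isBisection_specSupport (hv : v ∈ normalizers D) :
    (specGroupoid hD hF).IsBisection (specSupport D F v) := by
  refine ⟨_, isOpen_specSupport v, subset_rfl, isOpenEmbedding_domRestrict
    (isLocalHomeomorph_rangeMap hD hF) (isOpen_specSupport v) ?_, isOpenEmbedding_domRestrict
    (isLocalHomeomorph_sourceMap hD hF) (isOpen_specSupport v) ?_⟩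
  · intro α hα β hβ h
    rw [rangeMap_eq, rangeMap_eq, (unitHomeo hD hF).injective.eq_iff, specRng_eq, specRng_eq] at h
    refine (specInvHomeo hD hF).injective (injOn_specSrc hD hF (star_mem_normalizers hv) ?_ ?_ h)
    · change (specInv hD hF α : C → ℝ) _ ≠ 0
      rw [specInv_apply, star_star]; exact hα
    · change (specInv hD hF β : C → ℝ) _ ≠ 0
      rw [specInv_apply, star_star]; exact hβ
  · intro α hα β hβ h
    rw [sourceMap_eq, sourceMap_eq, (unitHomeo hD hF).injective.eq_iff] at h
    exact injOn_specSrc hD hF hv hα hβ h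

theorem t2Space_eigF : T2Space (eigF D F) :=
  have := weakDual_t2 (C := C)
  inferInstance

theorem locallyCompactSpace_specSupport (hD : IsRegularInclusion D) (hF : IsCompatibleCover D F)
    (hv : v ∈ normalizers D) :
    LocallyCompactSpace (specSupport D F v) :=
  have := weakDual_t2 (C := C)
  have := compactSpace_cover hF
  (isOpenEmbedding_specSrc hD hF hv).locallyCompactSpace

theorem locallyCompactSpace_specF (hD : IsRegularInclusion D) (hF : IsCompatibleCover D F) :
    LocallyCompactSpace (specF D F) := by
  refine locallyCompactSpace_of_open_cover fun α => ?_
  obtain ⟨v, hv, h⟩ := exists_spec_apply_ne_zero hD α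
  exact ⟨_, isOpen_specSupport v, h, locallyCompactSpace_specSupport hD hF hv⟩

theorem specGroupoid_isEtale : (specGroupoid hD hF).IsEtale where
  isTopological := specGroupoid_isTopological hD hF
  locallyCompact := locallyCompactSpace_specF hD hF
  isLocalHomeomorph := isLocalHomeomorph_rangeMap hD hF

/-! ### Local triviality of the circle action -/

theorem continuous_rotate :
    Continuous fun p : Circle × eigF D F => rotate hD hF p.1 p.2 := by
  refine continuous_of_apply fun x => ?_
  simp only [rotate_apply]
  exact (continuous_induced_dom.comp continuous_fst).mul
    ((continuous_eigF_apply x).comp continuous_snd)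

theorem norm_apply_div_specSection (φ : modulus D F ⁻¹' specSupport D F v) :
    ‖(φ.1 : WeakDual ℂ C) v / (specSection hD hF hv ⟨_, φ.2⟩ : WeakDual ℂ C) v‖ = 1 := by
  have h := modulus_eq_iff.mp (modulus_specSection hD hF hv ⟨_, φ.2⟩) v
  rw [norm_div, h]
  exact div_self φ.2

theorem rotate_specSection_mem (p : Circle × specSupport D F v) :
    rotate hD hF p.1 (specSection hD hF hv p.2) ∈ modulus D F ⁻¹' specSupport D F v := by
  rw [Set.mem_preimage, modulus_rotate, modulus_specSection]; exact p.2.2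

/-- Some scalar carries the section to φ because the moduli agree; evaluation at `v` identifies it
as the quotient. -/
theorem rotate_div_specSection (φ : modulus D F ⁻¹' specSupport D F v) :
    rotate hD hF (circleOf _ (norm_apply_div_specSection hD hF hv φ))
      (specSection hD hF hv ⟨_, φ.2⟩) = φ := by
  obtain ⟨z, hz⟩ := (modulus_eq_iff_exists_rotate hD hF).mp
    (modulus_specSection hD hF hv ⟨_, φ.2⟩).symm
  refine Eq.trans (congrArg (fun w => rotate hD hF w _) (Circle.ext ?_)) hz.symm
  rw [circleOf_coe, div_eq_iff (specSection_apply_ne_zero hD hF hv _), ← rotate_apply hD hF, ← hz]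

/-- The coordinates of an eigenfunctional in the trivialisation of the twist. -/
noncomputable def twistCoords (φ : modulus D F ⁻¹' specSupport D F v) :
    Circle × specSupport D F v :=
  (circleOf _ (norm_apply_div_specSection hD hF hv φ), ⟨modulus D F φ, φ.2⟩)

theorem continuous_twistCoords : Continuous (twistCoords hD hF hv) := by
  have h : Continuous fun φ : modulus D F ⁻¹' specSupport D F v =>
      (⟨modulus D F φ, φ.2⟩ : specSupport D F v) :=
    (continuous_modulus.comp continuous_subtype_val).subtype_mk _
  refine (continuous_induced_rng.mpr ?_).prodMk h
  exact ((continuous_eigF_apply v).comp continuous_subtype_val).div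
    ((continuous_eigF_apply v).comp ((continuous_specSection hD hF hv).comp h))
    fun φ => specSection_apply_ne_zero hD hF hv _

theorem twistCoords_rotate (p : Circle × specSupport D F v) :
    twistCoords hD hF hv ⟨_, rotate_specSection_mem hD hF hv p⟩ = p := by
  have h : (⟨modulus D F (rotate hD hF p.1 (specSection hD hF hv p.2)),
      rotate_specSection_mem hD hF hv p⟩ : specSupport D F v) = p.2 :=
    Subtype.ext ((modulus_rotate hD hF _ _).trans (modulus_specSection hD hF hv _))
  refine Prod.ext (Circle.ext ?_) h
  rw [twistCoords, circleOf_coe]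
  simp only [h, rotate_apply]
  exact mul_div_cancel_right₀ _ (specSection_apply_ne_zero hD hF hv p.2)

/-- The trivialisation of the twist over the moduli that do not vanish at `v`. -/
noncomputable def trivialisation :
    Circle × specSupport D F v ≃ₜ modulus D F ⁻¹' specSupport D F v where
  toFun p := ⟨_, rotate_specSection_mem hD hF hv p⟩
  invFun := twistCoords hD hF hv
  left_inv := twistCoords_rotate hD hF hv
  right_inv φ := Subtype.ext (rotate_div_specSection hD hF hv φ)
  continuous_toFun := ((continuous_rotate hD hF).comp (continuous_fst.prodMk
    ((continuous_specSection hD hF hv).comp continuous_snd))).subtype_mk _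
  continuous_invFun := continuous_twistCoords hD hF hv

theorem locallyCompactSpace_eigF (hD : IsRegularInclusion D) (hF : IsCompatibleCover D F) :
    LocallyCompactSpace (eigF D F) := by
  have := t2Space_eigF (D := D) (F := F)
  refine locallyCompactSpace_of_open_cover fun φ => ?_
  obtain ⟨v, hv, h⟩ := exists_apply_ne_zero hD φ
  have := locallyCompactSpace_specSupport hD hF hv
  exact ⟨_, (isOpen_specSupport v).preimage continuous_modulus, norm_ne_zero_iff.mpr h,
    (trivialisation hD hF hv).symm.isOpenEmbedding.locallyCompactSpace⟩

/-! ### The embedding of 𝕋 × F and the twist -/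

/-- The embedding `(z, f) ↦ z f`. -/
noncomputable def circleEmbed (p : Circle × F) : eigF D F :=
  rotate hD hF p.1 (unitEig hD hF p.2)

theorem circleEmbed_apply (z : Circle) (f : F) (x : C) :
    (circleEmbed hD hF (z, f) : WeakDual ℂ C) x = (z : ℂ) * (f : WeakDual ℂ C) x :=
  rotate_apply hD hF z _ x

theorem circleEmbed_apply_one (p : Circle × F) :
    (circleEmbed hD hF p : WeakDual ℂ C) 1 = p.1 := by
  rw [circleEmbed, rotate_apply, unitEig_one, mul_one]

theorem circleEmbed_one (f : F) : circleEmbed hD hF (1, f) = unitEig hD hF f :=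
  eigF_ext fun x => by rw [circleEmbed_apply, Circle.coe_one, one_mul, unitEig_coe]

theorem circleEmbed_apply_one_ne_zero (p : Circle × F) :
    (circleEmbed hD hF p : WeakDual ℂ C) 1 ≠ 0 := by
  rw [circleEmbed_apply_one]; exact Circle.coe_ne_zero _

theorem src_circleEmbed (p : Circle × F) : src (circleEmbed hD hF p) = p.2 := by
  rw [circleEmbed, src_rotate, src_unitEig]

theorem rng_circleEmbed (p : Circle × F) : rng hD hF (circleEmbed hD hF p) = p.2 := by
  rw [circleEmbed, rng_rotate, rng_unitEig]

/-- The unit of C is an admissible normalizer for zf, with value z. Together with the companion for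
right multiplication this gives centrality. -/
theorem eigMul_circleEmbed_left (z : Circle) (f : F) (φ : eigF D F)
    (h : src (circleEmbed hD hF (z, f)) = rng hD hF φ) :
    eigMul hD hF (circleEmbed hD hF (z, f)) φ h = rotate hD hF z φ := by
  refine eigMul_eq hD hF h one_mem_normalizers (circleEmbed_apply_one_ne_zero hD hF _) fun x => ?_
  have hz : (z : ℂ) * conj (z : ℂ) = 1 := by rw [Complex.mul_conj, Circle.normSq_coe]; simp
  rw [circleEmbed_apply_one, rotate_apply, star_one, one_mul, mul_right_comm, hz, one_mul]

theorem eigMul_circleEmbed_right (z : Circle) (f : F) (φ : eigF D F)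
    (h : src φ = rng hD hF (circleEmbed hD hF (z, f))) :
    eigMul hD hF φ (circleEmbed hD hF (z, f)) h = rotate hD hF z φ := by
  obtain ⟨v, hv, h₀⟩ := exists_apply_ne_zero hD φ
  refine eigMul_eq hD hF h hv h₀ fun x => ?_
  rw [rng_circleEmbed] at h
  rw [rotate_apply, circleEmbed_apply, mul_assoc, (isImplemented_src φ hv h₀).2, h]

theorem rotate_circleEmbed (z w : Circle) (f : F) :
    rotate hD hF z (circleEmbed hD hF (w, f)) = circleEmbed hD hF (z * w, f) :=
  eigF_ext fun x => by
    rw [rotate_apply, circleEmbed_apply, circleEmbed_apply, Circle.coe_mul, mul_assoc]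

theorem continuous_unitEig : Continuous (unitEig hD hF) :=
  continuous_of_apply fun x => continuous_state_apply x

theorem isEmbedding_unitEig : Topology.IsEmbedding (unitEig hD hF) :=
  .of_comp (continuous_unitEig hD hF) continuous_subtype_val Topology.IsEmbedding.subtypeVal

theorem injective_circleEmbed : Function.Injective (circleEmbed hD hF) := by
  intro p q h
  refine Prod.ext (Circle.ext ?_) ?_
  · rw [← circleEmbed_apply_one hD hF p, h, circleEmbed_apply_one]
  · rw [← src_circleEmbed hD hF p, h, src_circleEmbed]

theorem modulus_mem_units_iff (φ : eigF D F) :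
    modulus D F φ ∈ (specGroupoid hD hF).units ↔ ∃ p, circleEmbed hD hF p = φ := by
  rw [specGroupoid_units]
  constructor
  · rintro ⟨f, hf⟩
    obtain ⟨z, hz⟩ := (modulus_eq_iff_exists_rotate hD hF).mp hf.symm
    exact ⟨(z, f), hz.symm⟩
  · rintro ⟨p, rfl⟩
    exact ⟨p.2, (modulus_rotate hD hF _ _).symm⟩

theorem isTwist : IsTwist (eigGroupoid hD hF) (specGroupoid hD hF)
    (fun p => circleEmbed hD hF (p.1, (unitHomeo hD hF).symm p.2)) (modulus D F) where
  isTopological := eigGroupoid_isTopological hD hF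
  locallyCompact := locallyCompactSpace_eigF hD hF
  isEtale := specGroupoid_isEtale hD hF
  ι_continuous := (continuous_rotate hD hF).comp (continuous_fst.prodMk
    ((continuous_unitEig hD hF).comp ((unitHomeo hD hF).symm.continuous.comp continuous_snd)))
  q_continuous := continuous_modulus
  ι_hom := by
    rintro ⟨z, u⟩ ⟨w, u'⟩ (rfl : u = u')
    have h : src (circleEmbed hD hF (z, (unitHomeo hD hF).symm u)) =
        rng hD hF (circleEmbed hD hF (w, (unitHomeo hD hF).symm u)) := by
      rw [src_circleEmbed, rng_circleEmbed]
    exact ⟨h, ((eigMul_circleEmbed_left hD hF z _ _ h).trans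
      (rotate_circleEmbed hD hF z w _)).symm⟩
  q_hom := isHom_modulus hD hF
  ι_injective := (injective_circleEmbed hD hF).comp
    (Function.injective_id.prodMap (unitHomeo hD hF).symm.injective)
  q_surjective := modulus_surjective
  preimage_units := by
    ext φ
    rw [Set.mem_preimage, modulus_mem_units_iff]
    constructor
    · rintro ⟨p, rfl⟩
      exact ⟨(p.1, unitHomeo hD hF p.2), by simp⟩
    · rintro ⟨p, rfl⟩
      exact ⟨_, rfl⟩
  ι_one_embedding := by
    simp only [circleEmbed_one]
    exact (isEmbedding_unitEig hD hF).comp (unitHomeo hD hF).symm.isEmbedding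
  ι_one_range := by
    simp only [circleEmbed_one]
    rw [eigGroupoid_units]
    exact (unitHomeo hD hF).symm.surjective.range_comp (unitEig hD hF)
  q_units_embedding := by
    -- A unit is its own source state, so on units the quotient map factors as u ↦ s(u), then the
    -- homeomorphism of F with the units of the moduli, then inclusion.
    have h : (fun u : (eigGroupoid hD hF).units => modulus D F u) =
        fun u => ((unitHomeo hD hF (src u.1) : (specGroupoid hD hF).units) : specF D F) := by
      funext u
      obtain ⟨f, hf⟩ := (eigGroupoid_units hD hF).subset u.2
      rw [unitHomeo_coe, ← hf, src_unitEig]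
    have h₁ : Topology.IsEmbedding fun u : (eigGroupoid hD hF).units => src u.1 := by
      have h₂ : ∀ u : (eigGroupoid hD hF).units, (src u.1 : WeakDual ℂ C) = u.1 := fun u => by
        rw [← eigGroupoid_source hD hF, ← show u.1 = _ from u.2]
      refine .of_comp (continuous_of_apply fun x => ?_) continuous_subtype_val ?_
      · simp only [h₂]
        exact (continuous_eigF_apply x).comp continuous_subtype_val
      · rw [show Subtype.val ∘ (fun u : (eigGroupoid hD hF).units => src u.1) =
          Subtype.val ∘ Subtype.val from funext h₂]
        exact Topology.IsEmbedding.subtypeVal.comp Topology.IsEmbedding.subtypeVal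
    rw [h]
    exact Topology.IsEmbedding.subtypeVal.comp ((unitHomeo hD hF).isEmbedding.comp h₁)
  q_units_range := by
    rw [specGroupoid_units, ← Set.image_eq_range, eigGroupoid_units, ← Set.range_comp]
    rfl
  central φ z := by
    rw [rangeMap_eq, sourceMap_eq, specRng_modulus, specSrc_modulus hD hF]
    simp only [Homeomorph.symm_apply_apply]
    have h₁ : src (circleEmbed hD hF (z, rng hD hF φ)) = rng hD hF φ := src_circleEmbed hD hF _
    have h₂ : src φ = rng hD hF (circleEmbed hD hF (z, src φ)) :=
      (rng_circleEmbed hD hF (z, src φ)).symm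
    exact ⟨h₁, h₂, (eigMul_circleEmbed_left hD hF z _ φ h₁).trans
      (eigMul_circleEmbed_right hD hF z _ φ h₂).symm⟩
  locally_trivial α := by
    obtain ⟨v, hv, h⟩ := exists_spec_apply_ne_zero hD α
    have hc : ∀ (z : Circle) (u : specSupport D F v), src (circleEmbed hD hF
        (z, (unitHomeo hD hF).symm ((specGroupoid hD hF).rangeMap u))) =
          rng hD hF (specSection hD hF hv u) := by
      intro z u
      rw [src_circleEmbed, rangeMap_eq, Homeomorph.symm_apply_apply, ← specRng_modulus,
        modulus_specSection]
    -- Multiplying the section by ι(z, ·) is rotation by z, so the required map is `trivialisation`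
    -- followed by an inclusion.
    have hm : (fun p : Circle × specSupport D F v => eigMul hD hF _ _ (hc p.1 p.2)) =
        Subtype.val ∘ trivialisation hD hF hv :=
      funext fun p => eigMul_circleEmbed_left hD hF p.1 _ _ (hc p.1 p.2)
    refine ⟨specSupport D F v, isOpen_specSupport v, isBisection_specSupport hD hF hv, h,
      specSection hD hF hv, continuous_specSection hD hF hv, modulus_specSection hD hF hv, hc, ?_⟩
    change Topology.IsEmbedding (fun p : Circle × specSupport D F v =>
      eigMul hD hF _ _ (hc p.1 p.2)) ∧ Set.range (fun p : Circle × specSupport D F v =>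
      eigMul hD hF _ _ (hc p.1 p.2)) = _
    rw [hm]
    exact ⟨Topology.IsEmbedding.subtypeVal.comp (trivialisation hD hF hv).isEmbedding, by
      rw [(trivialisation hD hF hv).surjective.range_comp, Subtype.range_coe]⟩

end Operations

end RegIncl

theorem theorem7 {C : Type*} [CStarAlgebra C] (D : StarSubalgebra ℂ C)
    (hD : IsRegularInclusion D) (F : Set (WeakDual ℂ C)) (hF : IsCompatibleCover D F) :
    ∃ (E : SetGroupoid (eigF D F)) (R : SetGroupoid (specF D F)) (s r : eigF D F → F),
      -- the algebraic structures are the specified ones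
      IsEigGroupoid D F E s r ∧ IsSpecGroupoid D F E R ∧
      -- both are locally compact Hausdorff topological groupoids, the second one étale
      (E.IsTopological ∧ LocallyCompactSpace (eigF D F) ∧ T2Space (eigF D F)) ∧
      (R.IsTopological ∧ LocallyCompactSpace (specF D F) ∧ T2Space (specF D F)) ∧
      R.IsEtale ∧
      -- the unit space of `E` is `F`
      Subtype.val '' E.units = F ∧
      -- the unit space of `R` is `F`, where `f` is identified with `|f|`
      ∃ e : F ≃ₜ R.units,
        (∀ (f : F) (x : C), (e f : specF D F).1 x = ‖(f : WeakDual ℂ C) x‖) ∧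
        (∀ φ, R.sourceMap (modulus D F φ) = e (s φ) ∧ R.rangeMap (modulus D F φ) = e (r φ)) ∧
        -- the twist, with `ι (z, f) = z f`
        ∃ ι : Circle × F → eigF D F,
          (∀ (z : Circle) (f : F) (x : C),
            (ι (z, f) : WeakDual ℂ C) x = (z : ℂ) * (f : WeakDual ℂ C) x) ∧
          IsTwist E R (fun p => ι (p.1, e.symm p.2)) (modulus D F) := by
  refine ⟨eigGroupoid hD hF, specGroupoid hD hF, src, rng hD hF, isEigGroupoid hD hF,
    isSpecGroupoid hD hF,
    ⟨eigGroupoid_isTopological hD hF, locallyCompactSpace_eigF hD hF, t2Space_eigF⟩,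
    ⟨specGroupoid_isTopological hD hF, locallyCompactSpace_specF hD hF, inferInstance⟩,
    specGroupoid_isEtale hD hF, ?_, unitHomeo hD hF, fun _ _ => rfl, fun φ => ?_,
    circleEmbed hD hF, circleEmbed_apply hD hF, isTwist hD hF⟩
  · rw [eigGroupoid_units, ← Set.range_comp]
    exact Subtype.range_coe
  · rw [sourceMap_eq, rangeMap_eq, specSrc_modulus hD hF, specRng_modulus]
    exact ⟨rfl, rfl⟩
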